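/- **Theorem 3 (DLRE a.s. convergence).** *Network.* Let $m+1$ anchors ($\kappa$) and $M$ sensors ($\Omega$) be distinct points of $\mathbb{R}^m$, the anchors affinely independent and every sensor in their convex hull. For each sensor $l$ let $r_l>0$ and let $\Theta_l$ be a set of $m+1$ affinely independent nodes at distance less than $r_l$ from $l$, with $l\notin\Theta_l$ and $l$ in the convex hull of $\Theta_l$. Let $a_{ln}$ be the barycentric coordinates of $l$ with respect to $n\in\Theta_l$ ($a_{ln}=0$ for $n\notin\Theta_l$), $\mathbf{P}=(a_{ln})_{l,n\in\Omega}$, $\mathbf{B}=(a_{ln})_{l\in\Omega,n\in\kappa}$, and let $\mathbf{u}^j$ be the vector of the $j$-th coordinates of the anchors, $1\le j\le m$. *Random environment.* (C1) $\widehat{\mathbf{B}}(t)=\mathbf{B}+\mathbf{S}_{\mathbf{B}}+\widetilde{\mathbf{S}}_{\mathbf{B}}(t)$ and $\widehat{\mathbf{P}}(t)=\mathbf{P}+\mathbf{S}_{\mathbf{P}}+\widetilde{\mathbf{S}}_{\mathbf{P}}(t)$, where $\mathbf{S}_{\mathbf{B}},\mathbf{S}_{\mathbf{P}}$ are deterministic,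 the pairs $(\widetilde{\mathbf{S}}_{\mathbf{B}}(t),\widetilde{\mathbf{S}}_{\mathbf{P}}(t))$, $t\ge0$, are independent over $t$, with mean zero, $\sup_t\mathbb{E}\|\widetilde{\mathbf{S}}_{\mathbf{B}}(t)\|^2<\infty$ and $\sup_t\mathbb{E}\|\widetilde{\mathbf{S}}_{\mathbf{P}}(t)\|^2<\infty$; the entries $(l,n)$ of all these error matrices vanish for $n\notin\Theta_l$. (C2) For $n\in\Theta_l$, $e_{ln}(t)\in\{0,1\}$ and $\mathbb{P}[e_{ln}(t)=1]=q_{ln}$ with $0<q_{ln}\le1$; the families $(e_{ln}(t))_{l,\,n\in\Theta_l}$ are independent over $t$. (C3) The $v^j_{ln}(t)$ ($l\in\Omega$, $n\in\Theta_l$, $1\le j\le m$, $t\ge0$) are independent with mean zero and $\sup_{l,n,j,t}\mathbb{E}[v^j_{ln}(t)^2]<\infty$. (C4) The three collections $\{(\widetilde{\mathbf{S}}_{\mathbf{B}}(t),\widetilde{\mathbf{S}}_{\mathbf{P}}(t))\}$, $\{e_{ln}(t)\}$, $\{v^j_{ln}(t)\}$ are mutually independent. *Design assumptions.* (D1) $\alpha(t)>0$,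 $\sum_t\alpha(t)=\infty$, $\sum_t\alpha(t)^2<\infty$. (D2) The spectral radius satisfies $\rho(\mathbf{P}+\mathbf{S}_{\mathbf{P}})<1$. *Algorithm.* Let $\widetilde{\mathbf{B}}_{ln}(t)=\widehat{\mathbf{B}}_{ln}(t)\big(\tfrac{e_{ln}(t)}{q_{ln}}-1\big)$, $\widetilde{\mathbf{P}}_{ln}(t)=\widehat{\mathbf{P}}_{ln}(t)\big(\tfrac{e_{ln}(t)}{q_{ln}}-1\big)$ for $n\in\Theta_l$ (and $0$ otherwise), and $$\eta^j_l(t)=\sum_{n\in\Omega,\,n\ne l}\big(\widehat{\mathbf{P}}+\widetilde{\mathbf{P}}\big)_{ln}(t)\,v^j_{ln}(t)+\sum_{n\in\kappa}\big(\widehat{\mathbf{B}}+\widetilde{\mathbf{B}}\big)_{ln}(t)\,v^j_{ln}(t).$$ From an arbitrary (possibly random) initial state $\mathbf{x}^j(0)\in\mathbb{R}^M$, let $$\mathbf{x}^j(t+1)=\mathbf{x}^j(t)-\alpha(t)\big[(\mathbf{I}-\mathbf{P}-\mathbf{S}_{\mathbf{P}})\mathbf{x}^j(t)-(\mathbf{B}+\mathbf{S}_{\mathbf{B}})\mathbf{u}^j-(\widetilde{\mathbf{S}}_{\mathbf{P}}(t)+\widetilde{\mathbf{P}}(t))\mathbf{x}^j(t)-(\widetilde{\mathbf{S}}_{\mathbf{B}}(t)+\widetilde{\mathbf{B}}(t))\mathbf{u}^j-\eta^j(t)\big].$$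 *Conclusion.* $\mathbf{I}-\mathbf{P}-\mathbf{S}_{\mathbf{P}}$ is invertible and $$\mathbb{P}\Big[\lim_{t\to\infty}\mathbf{x}^j(t)=(\mathbf{I}-\mathbf{P}-\mathbf{S}_{\mathbf{P}})^{-1}(\mathbf{B}+\mathbf{S}_{\mathbf{B}})\mathbf{u}^j\ \text{ for all } j\Big]=1.$$ Moreover, with $\mathbf{U}=[\mathbf{u}^1,\dots,\mathbf{u}^m]$ and $\mathbf{X}^*$ the $M\times m$ matrix of exact sensor locations, the localization error $\|(\mathbf{I}-\mathbf{P}-\mathbf{S}_{\mathbf{P}})^{-1}(\mathbf{B}+\mathbf{S}_{\mathbf{B}})\mathbf{U}-\mathbf{X}^*\|$ is $0$ when $\mathbf{S}_{\mathbf{P}}=\mathbf{S}_{\mathbf{B}}=0$, and tends to $0$ as $(\mathbf{S}_{\mathbf{P}},\mathbf{S}_{\mathbf{B}})\to(0,0)$. -/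

import Mathlib

open MeasureTheory ProbabilityTheory Filter Topology

namespace DLRE

/-- The nodes of a network in `ℝ^m`: `m + 1` anchors (left summand, the set `κ`) and `M` sensors
with unknown locations (right summand, the set `Ω`). -/
abbrev Node (m M : ℕ) : Type := Fin (m + 1) ⊕ Fin M

/-- A triangulated sensor network in `ℝ^m`: distinct exact node locations, anchors in general
position, all sensors in the convex hull of the anchors, and for every sensor `l` a communication
radius `r l` and a triangulation set `Θ l`. Nonvanishing of the generalized volume of `m + 1`
points of `ℝ^m` is their affine independence. -/
structure SensorNetwork (m M : ℕ) where
  /-- the exact locations -/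
  pos : Node m M → EuclideanSpace ℝ (Fin m)
  pos_injective : Function.Injective pos
  anchors_nondegenerate : AffineIndependent ℝ (fun k : Fin (m + 1) => pos (Sum.inl k))
  sensors_mem_hull : ∀ l : Fin M,
    pos (Sum.inr l) ∈ convexHull ℝ (Set.range fun k : Fin (m + 1) => pos (Sum.inl k))
  /-- the communication radii -/
  r : Fin M → ℝ
  r_pos : ∀ l, 0 < r l
  /-- the triangulation sets -/
  Θ : Fin M → Finset (Node m M)
  dist_lt : ∀ l, ∀ k ∈ Θ l, dist (pos (Sum.inr l)) (pos k) < r l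
  self_notMem : ∀ l, Sum.inr l ∉ Θ l
  card_eq : ∀ l, (Θ l).card = m + 1
  nondegenerate : ∀ l, AffineIndependent ℝ (fun k : {k // k ∈ Θ l} => pos k)
  mem_hull : ∀ l, pos (Sum.inr l) ∈ convexHull ℝ (pos '' (Θ l : Set (Node m M)))

namespace SensorNetwork

variable {m M : ℕ} (net : SensorNetwork m M)

theorem affineSpan_triangulation (l : Fin M) :
    affineSpan ℝ (Set.range fun k : {k // k ∈ net.Θ l} => net.pos k) = ⊤ := by
  rw [(net.nondegenerate l).affineSpan_eq_top_iff_card_eq_finrank_add_one]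
  simp [net.card_eq l]

/-- The triangulation set of sensor `l` as an affine basis of `ℝ^m`. -/
noncomputable def triangulationBasis (l : Fin M) :
    AffineBasis {k // k ∈ net.Θ l} ℝ (EuclideanSpace ℝ (Fin m)) :=
  ⟨fun k => net.pos k, net.nondegenerate l, net.affineSpan_triangulation l⟩

/-- The barycentric coordinate `a_{lk}` of sensor `l` with respect to the node `k` of its
triangulation set; it is `0` for `k ∉ Θ l`. -/
noncomputable def bary (l : Fin M) (k : Node m M) : ℝ :=
  if h : k ∈ net.Θ l then (net.triangulationBasis l).coord ⟨k, h⟩ (net.pos (Sum.inr l)) else 0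

/-- The sensor-to-sensor system matrix `P`. -/
noncomputable def P : Matrix (Fin M) (Fin M) ℝ :=
  Matrix.of fun l n => net.bary l (Sum.inr n)

/-- The sensor-to-anchor system matrix `B`. -/
noncomputable def B : Matrix (Fin M) (Fin (m + 1)) ℝ :=
  Matrix.of fun l k => net.bary l (Sum.inl k)

/-- `u^j`, the vector of the `j`-th coordinates of the anchors. -/
def u (j : Fin m) : Fin (m + 1) → ℝ := fun k => net.pos (Sum.inl k) j

/-- The directed links `(l, n)`, `n ∈ Θ l`, used by the algorithm. -/
abbrev Link : Type := {p : Fin M × Node m M // p.2 ∈ net.Θ p.1}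

/-- The vector `(I - P - S_P)⁻¹ (B + S_B) u^j`. -/
noncomputable def steadyState (SP : Matrix (Fin M) (Fin M) ℝ)
    (SB : Matrix (Fin M) (Fin (m + 1)) ℝ) (j : Fin m) : Fin M → ℝ :=
  ((1 - net.P - SP)⁻¹ * (net.B + SB)).mulVec (net.u j)

/-- The localization error for the biases `S_P`, `S_B`: the Frobenius norm of the difference
between the matrix of steady-state estimates and the matrix of exact sensor locations. -/
noncomputable def localizationError (SP : Matrix (Fin M) (Fin M) ℝ)
    (SB : Matrix (Fin M) (Fin (m + 1)) ℝ) : ℝ :=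
  √(∑ l, ∑ j, (net.steadyState SP SB j l - net.pos (Sum.inr l) j) ^ 2)

end SensorNetwork

/-- A random environment for the network `net`: random system matrices, random link failures and
additive channel noise. The link variables `e`, `q`, `v` are only meaningful on links, that is,
for `n ∈ Θ l`. -/
structure RandomEnvironment {m M : ℕ} (net : SensorNetwork m M) {Ω : Type*} [MeasurableSpace Ω]
    (μ : Measure Ω) where
  /-- the mean measurement error `S_B` -/
  SB : Matrix (Fin M) (Fin (m + 1)) ℝ
  /-- the mean measurement error `S_P` -/
  SP : Matrix (Fin M) (Fin M) ℝ
  /-- the zero-mean part of the measurement error of `B` at time `t` -/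
  errB : ℕ → Ω → Matrix (Fin M) (Fin (m + 1)) ℝ
  /-- the zero-mean part of the measurement error of `P` at time `t` -/
  errP : ℕ → Ω → Matrix (Fin M) (Fin M) ℝ
  /-- the probabilities that the links are active -/
  q : Fin M → Node m M → ℝ
  /-- the state of the link `(l, n)` at time `t` -/
  e : Fin M → Node m M → ℕ → Ω → ℝ
  /-- the channel noise on the `j`-th coordinate over the link `(l, n)` at time `t` -/
  v : Fin M → Node m M → Fin m → ℕ → Ω → ℝ
  -- sensor `l` estimates the coefficients of the nodes of its triangulation set only
  SB_support : ∀ l k, Sum.inl k ∉ net.Θ l → SB l k = 0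
  SP_support : ∀ l n, Sum.inr n ∉ net.Θ l → SP l n = 0
  errB_support : ∀ t ω l k, Sum.inl k ∉ net.Θ l → errB t ω l k = 0
  errP_support : ∀ t ω l n, Sum.inr n ∉ net.Θ l → errP t ω l n = 0
  -- randomness in the system matrices
  errB_measurable : ∀ t l k, Measurable fun ω => errB t ω l k
  errP_measurable : ∀ t l n, Measurable fun ω => errP t ω l n
  errB_memLp : ∀ t l k, MemLp (fun ω => errB t ω l k) 2 μ
  errP_memLp : ∀ t l n, MemLp (fun ω => errP t ω l n) 2 μ
  errB_mean : ∀ t l k, ∫ ω, errB t ω l k ∂μ = 0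
  errP_mean : ∀ t l n, ∫ ω, errP t ω l n ∂μ = 0
  errB_bound : ∃ c : ℝ, ∀ t, ∫ ω, ∑ l, ∑ k, errB t ω l k ^ 2 ∂μ ≤ c
  errP_bound : ∃ c : ℝ, ∀ t, ∫ ω, ∑ l, ∑ n, errP t ω l n ^ 2 ∂μ ≤ c
  err_indep : iIndepFun
    (fun (t : ℕ) (ω : Ω) => ((fun l k => errB t ω l k, fun l n => errP t ω l n) :
      (Fin M → Fin (m + 1) → ℝ) × (Fin M → Fin M → ℝ))) μ
  -- random link failures
  q_pos : ∀ l, ∀ n ∈ net.Θ l, 0 < q l n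
  q_le_one : ∀ l, ∀ n ∈ net.Θ l, q l n ≤ 1
  e_measurable : ∀ l, ∀ n ∈ net.Θ l, ∀ t, Measurable (e l n t)
  e_binary : ∀ l, ∀ n ∈ net.Θ l, ∀ t ω, e l n t ω = 0 ∨ e l n t ω = 1
  e_prob : ∀ l, ∀ n ∈ net.Θ l, ∀ t, μ {ω | e l n t ω = 1} = ENNReal.ofReal (q l n)
  e_indep : iIndepFun (fun (t : ℕ) (ω : Ω) (p : net.Link) => e p.1.1 p.1.2 t ω) μ
  -- additive channel noise
  v_measurable : ∀ l, ∀ n ∈ net.Θ l, ∀ j t, Measurable (v l n j t)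
  v_memLp : ∀ l, ∀ n ∈ net.Θ l, ∀ j t, MemLp (v l n j t) 2 μ
  v_mean : ∀ l, ∀ n ∈ net.Θ l, ∀ j t, ∫ ω, v l n j t ω ∂μ = 0
  v_bound : ∃ c : ℝ, ∀ l, ∀ n ∈ net.Θ l, ∀ j t, ∫ ω, v l n j t ω ^ 2 ∂μ ≤ c
  v_indep : iIndepFun
    (fun (i : net.Link × Fin m × ℕ) (ω : Ω) => v i.1.1.1 i.1.1.2 i.2.1 i.2.2 ω) μ
  -- mutual independence of the three sources of randomness
  indep : iIndep
    ![MeasurableSpace.comap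
        (fun (ω : Ω) (t : ℕ) => ((fun l k => errB t ω l k, fun l n => errP t ω l n) :
          (Fin M → Fin (m + 1) → ℝ) × (Fin M → Fin M → ℝ))) inferInstance,
      MeasurableSpace.comap
        (fun (ω : Ω) (i : net.Link × ℕ) => e i.1.1.1 i.1.1.2 i.2 ω) inferInstance,
      MeasurableSpace.comap
        (fun (ω : Ω) (i : net.Link × Fin m × ℕ) => v i.1.1.1 i.1.1.2 i.2.1 i.2.2 ω)
        inferInstance] μ

namespace RandomEnvironment

variable {m M : ℕ} {net : SensorNetwork m M} {Ω : Type*} [MeasurableSpace Ω] {μ : Measure Ω}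
  (env : RandomEnvironment net μ)

/-- The noisy system matrix `B̂(t) = B + S_B + S̃_B(t)`. -/
noncomputable def hatB (t : ℕ) (ω : Ω) : Matrix (Fin M) (Fin (m + 1)) ℝ :=
  net.B + env.SB + env.errB t ω

/-- The noisy system matrix `P̂(t) = P + S_P + S̃_P(t)`. -/
noncomputable def hatP (t : ℕ) (ω : Ω) : Matrix (Fin M) (Fin M) ℝ :=
  net.P + env.SP + env.errP t ω

/-- The matrix `B̃(t)`, the fluctuation caused by link failures. -/
noncomputable def tildeB (t : ℕ) (ω : Ω) : Matrix (Fin M) (Fin (m + 1)) ℝ :=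
  Matrix.of fun l k => env.hatB t ω l k * (env.e l (Sum.inl k) t ω / env.q l (Sum.inl k) - 1)

/-- The matrix `P̃(t)`, the fluctuation caused by link failures. -/
noncomputable def tildeP (t : ℕ) (ω : Ω) : Matrix (Fin M) (Fin M) ℝ :=
  Matrix.of fun l n => env.hatP t ω l n * (env.e l (Sum.inr n) t ω / env.q l (Sum.inr n) - 1)

/-- The vector `η^j(t)`, the total received channel noise. -/
noncomputable def eta (j : Fin m) (t : ℕ) (ω : Ω) : Fin M → ℝ := fun l =>
  (∑ n with n ≠ l, (env.hatP t ω + env.tildeP t ω) l n * env.v l (Sum.inr n) j t ω) +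
    ∑ k, (env.hatB t ω + env.tildeB t ω) l k * env.v l (Sum.inl k) j t ω

/-- The state `x^j(t)` of the algorithm in the realization `ω`, with weights `α`, started at
`x₀`. -/
noncomputable def state (α : ℕ → ℝ) (j : Fin m) (x₀ : Fin M → ℝ) (ω : Ω) : ℕ → Fin M → ℝ
  | 0 => x₀
  | t + 1 =>
    let x := state α j x₀ ω t
    x - α t • ((1 - net.P - env.SP).mulVec x - (net.B + env.SB).mulVec (net.u j)
      - (env.errP t ω + env.tildeP t ω).mulVec x
      - (env.errB t ω + env.tildeB t ω).mulVec (net.u j) - env.eta j t ω)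

end RandomEnvironment

end DLRE

/-! With `z` the claimed limit, the error `y = x - z` obeys `y(t+1) = y(t) - α(t)(y(t) - W y(t) -
ξ(t))`, where `W = P + S_P` and `ξ(t)` is the sum of a multiplicative part `D(t) y(t)` and an
additive part `d(t)`. The entries of `D(t)` and `d(t)` are centred, bounded in L² and independent of
the past.

Spectral radius below one does not make `W` a contraction in the given norm, but
`exists_contracting_embedding` supplies a Hilbert norm `‖T ·‖` in which it is one. In this norm the
drift increases the squared error by a relative `O(α(t)²)` at most, the cross term with the
martingale difference `ξ(t)` has mean zero, and `E ξ(t)²` is controlled by `1 + E‖T y(t)‖²`. Square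
summability of `α` therefore bounds `E‖T y(t)‖²`. It follows that each coordinate series `∑ α(t)
ξ(t)` is an L²-bounded martingale and converges almost surely. On each such path the tail of the
series is added to `y`, which leaves a noise-free contracting recursion with a vanishing
perturbation; divergence of `∑ α(t)` forces it to zero
(`ae_tendsto_zero_of_linear_stochastic_approximation`).

This argument treats a deterministic initial state. For fixed noise the state is affine in the
initial state, so convergence from the origin and from the basis vectors gives convergence from
every initial state on one common event of full measure, whatever the random initial state is.

The localization error is a matter of geometry. Barycentric coordinates reproduce the positions, so
the exact locations solve the unbiased system, and a maximum principle for convex weights makes `1 -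
P` invertible. Continuity of matrix inversion at an invertible matrix gives the limit. -/

/-! ### Contracting norms and deterministic recursions -/

section Deterministic

-- Gelfand's formula: for any `r` strictly between the spectral radius and one, `‖A ^ n‖ ≤ r ^ n`
-- eventually.
open scoped Matrix.Norms.L2Operator in
theorem tendsto_norm_pow_of_spectralRadius_lt_one {ι : Type*} [Fintype ι] [DecidableEq ι]
    (A : Matrix ι ι ℂ) (h : spectralRadius ℂ A < 1) :
    Tendsto (fun n => ‖A ^ n‖) atTop (𝓝 0) := by
  obtain ⟨r, hr, hr1⟩ := ENNReal.lt_iff_exists_nnreal_btwn.1 h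
  have hr1' : (r : ℝ) < 1 := by exact_mod_cast hr1
  have hev := (spectrum.pow_nnnorm_pow_one_div_tendsto_nhds_spectralRadius A).eventually_lt_const hr
  refine squeeze_zero' (Eventually.of_forall fun n => norm_nonneg _) ?_
    (tendsto_pow_atTop_nhds_zero_of_lt_one r.2 hr1')
  filter_upwards [hev, eventually_gt_atTop 0] with n hn hn0
  have hn' : (n : ℝ) ≠ 0 := by positivity
  have h1 := ENNReal.rpow_le_rpow hn.le (Nat.cast_nonneg (α := ℝ) n)
  rw [← ENNReal.rpow_mul, one_div_mul_cancel hn', ENNReal.rpow_one, ENNReal.rpow_natCast] at h1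
  exact_mod_cast h1

open scoped Matrix.Norms.L2Operator in
theorem exists_pow_mulVec_sq_le {ι : Type*} [Fintype ι] [DecidableEq ι] (W : Matrix ι ι ℝ)
    (h : spectralRadius ℂ (W.map (algebraMap ℝ ℂ)) < 1) :
    ∃ N : ℕ, ∀ x : ι → ℝ, ∑ i, ((W ^ N).mulVec x i) ^ 2 ≤ 1 / 2 * ∑ i, x i ^ 2 := by
  have h1 := (tendsto_norm_pow_of_spectralRadius_lt_one _ h).eventually_lt_const
    (show (0 : ℝ) < 1 / 2 by norm_num)
  obtain ⟨N, hN⟩ := h1.exists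
  refine ⟨N, fun x => ?_⟩
  have h2 := Matrix.l2_opNorm_mulVec ((W.map (algebraMap ℝ ℂ)) ^ N)
    (WithLp.toLp 2 fun i => (x i : ℂ))
  have h3 : ‖((EuclideanSpace.equiv ι ℂ).symm <| ((W.map (algebraMap ℝ ℂ)) ^ N).mulVec
      (fun i => (x i : ℂ)))‖ ^ 2 = ∑ i, ((W ^ N).mulVec x i) ^ 2 := by
    rw [EuclideanSpace.norm_sq_eq]
    refine Finset.sum_congr rfl fun i _ => ?_
    have : ((EuclideanSpace.equiv ι ℂ).symm (((W.map (algebraMap ℝ ℂ)) ^ N).mulVec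
        (fun i => (x i : ℂ)))) i = (((W ^ N).mulVec x i : ℝ) : ℂ) := by
      rw [← Matrix.map_pow]
      simp [Matrix.mulVec, dotProduct]
    rw [this]
    simp
  have h4 : ‖(WithLp.toLp 2 fun i => (x i : ℂ) : EuclideanSpace ℂ ι)‖ ^ 2 = ∑ i, x i ^ 2 := by
    rw [EuclideanSpace.norm_sq_eq]; simp
  rw [← h3, ← h4]
  have h5 := h2.trans (mul_le_mul_of_nonneg_right hN.le (norm_nonneg _))
  have h6 := pow_le_pow_left₀ (norm_nonneg _) h5 2
  refine h6.trans ?_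
  rw [mul_pow]
  exact mul_le_mul_of_nonneg_right (by norm_num) (sq_nonneg _)

theorem LinearMap.exists_norm_sq_le_sum_sq {ι κ : Type*} [Fintype ι] [Fintype κ]
    (T : (ι → ℝ) →ₗ[ℝ] EuclideanSpace ℝ κ) :
    ∃ K : ℝ, 0 ≤ K ∧ ∀ x, ‖T x‖ ^ 2 ≤ K * ∑ i, x i ^ 2 := by
  let S : EuclideanSpace ℝ ι →L[ℝ] EuclideanSpace ℝ κ :=
    LinearMap.toContinuousLinearMap (T ∘ₗ (WithLp.linearEquiv 2 ℝ (ι → ℝ)).toLinearMap)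
  refine ⟨‖S‖ ^ 2, sq_nonneg _, fun x => ?_⟩
  have h1 := pow_le_pow_left₀ (norm_nonneg _) (S.le_opNorm (WithLp.toLp 2 x)) 2
  have h3 : ‖(WithLp.toLp 2 x : EuclideanSpace ℝ ι)‖ ^ 2 = ∑ i, x i ^ 2 := by
    rw [EuclideanSpace.norm_sq_eq]; simp
  rwa [mul_pow, h3] at h1

/-- A matrix of spectral radius less than one is a strict contraction for a Hilbert norm. -/
theorem exists_contracting_embedding {ι : Type*} [Fintype ι] [DecidableEq ι] (W : Matrix ι ι ℝ)
    (h : spectralRadius ℂ (W.map (algebraMap ℝ ℂ)) < 1) :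
    ∃ (N : ℕ) (T : (ι → ℝ) →ₗ[ℝ] EuclideanSpace ℝ (Fin N × ι)) (c : ℝ), 0 ≤ c ∧ c < 1 ∧
      (∀ x, ‖T (W.mulVec x)‖ ≤ c * ‖T x‖) ∧ ∀ x i, |x i| ≤ 2 * ‖T x‖ := by
  obtain ⟨N, hN⟩ := exists_pow_mulVec_sq_le W h
  -- `T` lists the orbit segment `x, W x, ..., W^(N-1) x`, so the new norm is Euclidean and inner
  -- products remain available for the second-moment estimates.
  let T : (ι → ℝ) →ₗ[ℝ] EuclideanSpace ℝ (Fin N × ι) :=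
    { toFun := fun x => WithLp.toLp 2 fun p => ((W ^ (p.1 : ℕ)).mulVec x) p.2
      map_add' := fun x y => by ext p; simp [Matrix.mulVec_add]
      map_smul' := fun a x => by ext p; simp [Matrix.mulVec_smul] }
  let f : ℕ → (ι → ℝ) → ℝ := fun k x => ∑ i, ((W ^ k).mulVec x i) ^ 2
  have hf0 : ∀ k x, 0 ≤ f k x := fun k x => Finset.sum_nonneg fun i _ => sq_nonneg _
  have hT : ∀ x, ‖T x‖ ^ 2 = ∑ k ∈ Finset.range N, f k x := by
    intro x
    rw [EuclideanSpace.norm_sq_eq, Fintype.sum_prod_type, Finset.sum_range]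
    simp [T, f]
  -- Applying `W` shifts the orbit: the first term leaves the sum and the `N`-th enters. As the
  -- latter is at most half of the former, at least `f 0 x / 2` is lost, which is a fixed fraction
  -- of `‖T x‖ ^ 2`.
  have hTW : ∀ x, ‖T (W.mulVec x)‖ ^ 2 + f 0 x = ‖T x‖ ^ 2 + f N x := by
    intro x
    have h1 : ∀ k, f k (W.mulVec x) = f (k + 1) x := by
      intro k
      simp only [f, Matrix.mulVec_mulVec, pow_succ]
    rw [hT, hT]
    simp only [h1]
    rw [← Finset.sum_range_succ' (fun k => f k x), Finset.sum_range_succ]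
  have hfN : ∀ x, f N x ≤ 1 / 2 * f 0 x := fun x => by
    simpa [f] using hN x
  -- The bound `1 ≤ K` keeps `1 - 1 / (2 * K)`, the squared contraction factor, nonnegative.
  obtain ⟨K, hK1, hK⟩ : ∃ K : ℝ, 1 ≤ K ∧ ∀ x, ‖T x‖ ^ 2 ≤ K * f 0 x := by
    obtain ⟨K, hK0, hK⟩ := T.exists_norm_sq_le_sum_sq
    refine ⟨K + 1, by linarith, fun x => ?_⟩
    have h1 : ∑ i, x i ^ 2 = f 0 x := by simp [f]
    have h2 := hK x
    rw [h1] at h2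
    nlinarith [hf0 0 x]
  have hlow : ∀ x, f 0 x ≤ 2 * ‖T x‖ ^ 2 := by
    intro x
    nlinarith [hTW x, hfN x, sq_nonneg ‖T (W.mulVec x)‖]
  have hc : 0 ≤ 1 - 1 / (2 * K) := by
    rw [sub_nonneg, div_le_one (by linarith)]; linarith
  refine ⟨N, T, √(1 - 1 / (2 * K)), Real.sqrt_nonneg _, ?_, fun x => ?_, fun x i => ?_⟩
  · rw [Real.sqrt_lt' one_pos]
    have : 0 < 1 / (2 * K) := by positivity
    linarith
  · refine abs_le_of_sq_le_sq' ?_ (by positivity) |>.2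
    rw [mul_pow, Real.sq_sqrt hc]
    have h1 : 1 / (2 * K) * ‖T x‖ ^ 2 ≤ 1 / 2 * f 0 x := by
      rw [div_mul_eq_mul_div, div_le_iff₀ (by linarith)]
      nlinarith [hK x]
    nlinarith [hTW x, hfN x]
  · refine abs_le_of_sq_le_sq ?_ (by positivity)
    have h1 : x i ^ 2 ≤ f 0 x := by
      simp only [f, pow_zero, Matrix.one_mulVec]
      exact Finset.single_le_sum (f := fun i => x i ^ 2) (fun i _ => sq_nonneg _) (Finset.mem_univ i)
    nlinarith [hlow x, sq_nonneg ‖T x‖]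

/-- Once `r t < δ * (ε / 2)`, the excess of `a` over `ε / 2` is multiplied by at most `1 - δ * α t ≤
exp (-δ * α t)` at each step, and the product of these factors tends to zero because `∑ α` diverges.
-/
theorem tendsto_zero_of_le_one_sub_mul_add {a r α : ℕ → ℝ} {δ : ℝ} (hδ : 0 < δ)
    (ha : ∀ t, 0 ≤ a t) (hα : ∀ t, 0 < α t)
    (hα_sum : Tendsto (fun n => ∑ t ∈ Finset.range n, α t) atTop atTop)
    (hα0 : Tendsto α atTop (𝓝 0)) (hr : Tendsto r atTop (𝓝 0))
    (h : ∀ᶠ t in atTop, a (t + 1) ≤ (1 - δ * α t) * a t + α t * r t) :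
    Tendsto a atTop (𝓝 0) := by
  rw [Metric.tendsto_atTop]
  intro ε hε
  have hsmall : ∀ᶠ t in atTop, δ * α t < 1 := by
    have := hα0.const_mul δ
    rw [mul_zero] at this
    exact this.eventually_lt_const one_pos
  have hrs : ∀ᶠ t in atTop, r t < δ * (ε / 2) := hr.eventually_lt_const (by positivity)
  obtain ⟨t₀, ht₀⟩ := eventually_atTop.1 (h.and (hsmall.and hrs))
  -- The excess may be negative; comparing with `a t₀` instead of `a t₀ - ε / 2` keeps the right
  -- side nonnegative, as replacing `1 - δ * α` by the exponential requires.
  have key : ∀ n, a (t₀ + n) - ε / 2 ≤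
      Real.exp (-δ * ∑ t ∈ Finset.range n, α (t₀ + t)) * a t₀ := by
    intro n
    induction n with
    | zero => simp; linarith
    | succ n ih =>
      obtain ⟨h1, h2, h3⟩ := ht₀ (t₀ + n) (by omega)
      have h4 : a (t₀ + (n + 1)) - ε / 2 ≤ (1 - δ * α (t₀ + n)) * (a (t₀ + n) - ε / 2) := by
        rw [← add_assoc]
        nlinarith [mul_lt_mul_of_pos_left h3 (hα (t₀ + n))]
      rw [Finset.sum_range_succ, mul_add, Real.exp_add]
      have h5 : 1 - δ * α (t₀ + n) ≤ Real.exp (-δ * α (t₀ + n)) := by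
        have := Real.add_one_le_exp (-δ * α (t₀ + n)); linarith
      have hp : 0 ≤ Real.exp (-δ * ∑ t ∈ Finset.range n, α (t₀ + t)) * a t₀ :=
        mul_nonneg (Real.exp_pos _).le (ha _)
      calc _ ≤ _ := h4
        _ ≤ (1 - δ * α (t₀ + n)) * (Real.exp (-δ * ∑ t ∈ Finset.range n, α (t₀ + t)) * a t₀) :=
          mul_le_mul_of_nonneg_left ih (by linarith)
        _ ≤ Real.exp (-δ * α (t₀ + n)) * (Real.exp (-δ * ∑ t ∈ Finset.range n, α (t₀ + t)) * a t₀) :=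
          mul_le_mul_of_nonneg_right h5 hp
        _ = _ := by ring
  have hsum : Tendsto (fun n => ∑ t ∈ Finset.range n, α (t₀ + t)) atTop atTop := by
    have h1 : ∀ n, ∑ t ∈ Finset.range n, α (t₀ + t) =
        -(∑ t ∈ Finset.range t₀, α t) + ∑ t ∈ Finset.range (n + t₀), α t := by
      intro n
      rw [add_comm n t₀, Finset.sum_range_add]; ring
    simp only [h1]
    exact tendsto_atTop_add_const_left _ _ ((tendsto_add_atTop_iff_nat t₀).2 hα_sum)
  have hexp : Tendsto (fun n => Real.exp (-δ * ∑ t ∈ Finset.range n, α (t₀ + t)) * a t₀)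
      atTop (𝓝 0) := by
    have : Tendsto (fun n => -δ * ∑ t ∈ Finset.range n, α (t₀ + t)) atTop atBot :=
      hsum.const_mul_atTop_of_neg (by linarith)
    simpa using (Real.tendsto_exp_atBot.comp this).mul_const (a t₀)
  obtain ⟨n₀, hn₀⟩ := eventually_atTop.1 (hexp.eventually_lt_const (half_pos hε))
  refine ⟨t₀ + n₀, fun t ht => ?_⟩
  obtain ⟨n, rfl⟩ := Nat.exists_eq_add_of_le (show t₀ ≤ t by omega)
  have := key n
  have := hn₀ n (by omega)
  rw [Real.dist_eq, sub_zero, abs_of_nonneg (ha _)]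
  linarith

/-- The noise need not be small, only its weighted series convergent. With `R` the tail of that
series, `y + R` absorbs the noise exactly and is driven only by `α t • (R t - W R t)`, where `R`
tends to zero. -/
theorem tendsto_zero_of_summable_perturbation {ι : Type*} [Fintype ι] [DecidableEq ι]
    {W : Matrix ι ι ℝ} {N : ℕ} (T : (ι → ℝ) →ₗ[ℝ] EuclideanSpace ℝ (Fin N × ι)) {c : ℝ}
    (hc1 : c < 1) (hTW : ∀ x, ‖T (W.mulVec x)‖ ≤ c * ‖T x‖)
    (hT : ∀ x i, |x i| ≤ 2 * ‖T x‖)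
    {α : ℕ → ℝ} (hα : ∀ t, 0 < α t)
    (hα_sum : Tendsto (fun n => ∑ t ∈ Finset.range n, α t) atTop atTop)
    (hα0 : Tendsto α atTop (𝓝 0)) {y ξ : ℕ → ι → ℝ}
    (hy : ∀ t, y (t + 1) = y t - α t • (y t - W.mulVec (y t) - ξ t))
    (hξ : ∀ i, ∃ s, Tendsto (fun n => ∑ t ∈ Finset.range n, α t * ξ t i) atTop (𝓝 s)) :
    Tendsto y atTop (𝓝 0) := by
  choose s hs using hξ
  let R : ℕ → ι → ℝ := fun n => s - ∑ t ∈ Finset.range n, α t • ξ t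
  have hR : Tendsto R atTop (𝓝 0) := by
    rw [tendsto_pi_nhds]
    intro i
    simpa [R, Finset.sum_apply] using (hs i).const_sub (s i)
  have hTc : Continuous T := T.continuous_of_finiteDimensional
  have hTR : Tendsto (fun n => ‖T (R n)‖) atTop (𝓝 0) := by
    simpa using ((hTc.tendsto 0).comp hR).norm
  have hz : Tendsto (fun t => ‖T (y t + R t)‖) atTop (𝓝 0) := by
    refine tendsto_zero_of_le_one_sub_mul_add (δ := 1 - c) (r := fun t => 2 * ‖T (R t)‖)
      (by linarith) (fun _ => norm_nonneg _) hα hα_sum hα0 (by simpa using hTR.const_mul 2) ?_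
    filter_upwards [hα0.eventually_lt_const one_pos] with t ht
    have h1 : y (t + 1) + R (t + 1) = (1 - α t) • (y t + R t) + α t • W.mulVec (y t + R t)
        + α t • (R t - W.mulVec (R t)) := by
      have h2 : R (t + 1) = R t - α t • ξ t := by
        simp only [R, Finset.sum_range_succ]; abel
      rw [hy, h2, Matrix.mulVec_add]
      module
    rw [h1]
    simp only [map_add, map_smul, map_sub]
    have h3 := hTW (y t + R t)
    have h4 := hTW (R t)
    have h5 := norm_sub_le (T (R t)) (T (W.mulVec (R t)))
    have h6 : ‖T (R t) - T (W.mulVec (R t))‖ ≤ 2 * ‖T (R t)‖ := by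
      nlinarith [norm_nonneg (T (R t))]
    rw [map_add] at h3
    refine (norm_add₃_le).trans ?_
    rw [← map_add, norm_smul, norm_smul, norm_smul, Real.norm_of_nonneg (hα t).le,
      Real.norm_of_nonneg (by linarith : 0 ≤ 1 - α t)]
    rw [← map_add] at h3
    have h7 := mul_le_mul_of_nonneg_left h3 (hα t).le
    have h8 := mul_le_mul_of_nonneg_left h6 (hα t).le
    linarith
  have hz' : Tendsto (fun t => y t + R t) atTop (𝓝 0) := by
    rw [tendsto_pi_nhds]
    intro i
    rw [Pi.zero_apply, tendsto_zero_iff_abs_tendsto_zero]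
    exact squeeze_zero (fun _ => abs_nonneg _) (fun t => hT _ i) (by simpa using hz.const_mul 2)
  simpa using hz'.sub hR

end Deterministic

/-! ### Square-integrable noise, independence and martingale convergence -/

section Noise

variable {Ω : Type*} {mΩ : MeasurableSpace Ω}

/-- A centred square-integrable process, bounded in `L²`, whose value at time `t` is measurable
for `G t`. -/
structure IsNoise (G : ℕ → MeasurableSpace Ω) (μ : Measure Ω) (ζ : ℕ → Ω → ℝ) : Prop where
  measurable : ∀ t, Measurable[G t] (ζ t)
  memLp : ∀ t, MemLp (ζ t) 2 μ
  integral_eq_zero : ∀ t, ∫ ω, ζ t ω ∂μ = 0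
  bdd : ∃ c : ℝ, ∀ t, ∫ ω, ζ t ω ^ 2 ∂μ ≤ c

namespace IsNoise

variable {G : ℕ → MeasurableSpace Ω} {μ : Measure Ω} {ζ ζ' : ℕ → Ω → ℝ}

theorem zero : IsNoise G μ (fun _ _ => 0) where
  measurable _ := measurable_const
  memLp _ := MemLp.zero
  integral_eq_zero _ := by simp
  bdd := ⟨0, fun _ => by simp⟩

theorem add [IsProbabilityMeasure μ] (h : IsNoise G μ ζ) (h' : IsNoise G μ ζ') :
    IsNoise G μ (fun t ω => ζ t ω + ζ' t ω) where
  measurable t := (h.measurable t).add (h'.measurable t)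
  memLp t := (h.memLp t).add (h'.memLp t)
  integral_eq_zero t := by
    rw [integral_add ((h.memLp t).integrable one_le_two) ((h'.memLp t).integrable one_le_two),
      h.integral_eq_zero, h'.integral_eq_zero, add_zero]
  bdd := by
    obtain ⟨c, hc⟩ := h.bdd
    obtain ⟨c', hc'⟩ := h'.bdd
    refine ⟨2 * c + 2 * c', fun t => ?_⟩
    have h1 : ∫ ω, (ζ t ω + ζ' t ω) ^ 2 ∂μ ≤ ∫ ω, (2 * ζ t ω ^ 2 + 2 * ζ' t ω ^ 2) ∂μ :=
      integral_mono ((h.memLp t).add (h'.memLp t)).integrable_sq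
        (((h.memLp t).integrable_sq.const_mul 2).add ((h'.memLp t).integrable_sq.const_mul 2))
        fun ω => by
          have := sq_nonneg (ζ t ω - ζ' t ω)
          simp only
          linarith
    rw [integral_add ((h.memLp t).integrable_sq.const_mul 2)
      ((h'.memLp t).integrable_sq.const_mul 2), integral_const_mul, integral_const_mul] at h1
    linarith [hc t, hc' t]

theorem mul_const (h : IsNoise G μ ζ) (a : ℝ) : IsNoise G μ (fun t ω => ζ t ω * a) where
  measurable t := (h.measurable t).mul_const a
  memLp t := by simpa only [mul_comm] using (h.memLp t).const_mul a
  integral_eq_zero t := by rw [integral_mul_const, h.integral_eq_zero, zero_mul]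
  bdd := by
    obtain ⟨c, hc⟩ := h.bdd
    refine ⟨c * a ^ 2, fun t => ?_⟩
    simp only [mul_pow]
    rw [integral_mul_const]
    exact mul_le_mul_of_nonneg_right (hc t) (sq_nonneg a)

theorem sum [IsProbabilityMeasure μ] {κ : Type*} (s : Finset κ) {ζ : κ → ℕ → Ω → ℝ}
    (h : ∀ k ∈ s, IsNoise G μ (ζ k)) : IsNoise G μ (fun t ω => ∑ k ∈ s, ζ k t ω) := by
  classical
  induction s using Finset.induction_on with
  | empty => simpa using zero
  | insert k s hk ih =>
    simp only [Finset.sum_insert hk]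
    exact (h k (Finset.mem_insert_self k s)).add
      (ih fun i hi => h i (Finset.mem_insert_of_mem hi))

end IsNoise

/-- The filtration of the strict past of a sequence of `σ`-algebras. -/
def pastFiltration (G : ℕ → MeasurableSpace Ω) (hG : ∀ t, G t ≤ mΩ) : Filtration ℕ mΩ where
  seq t := ⨆ s ∈ Set.Iio t, G s
  mono' _ _ h := biSup_mono fun _ hs => lt_of_lt_of_le hs h
  le' _ := iSup₂_le fun s _ => hG s

theorem le_pastFiltration_succ (G : ℕ → MeasurableSpace Ω) (hG : ∀ t, G t ≤ mΩ) (t : ℕ) :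
    G t ≤ pastFiltration G hG (t + 1) :=
  le_iSup₂_of_le (f := fun s (_ : s ∈ Set.Iio (t + 1)) => G s) t (Nat.lt_succ_self t) le_rfl

section Product

variable {μ : Measure Ω} {m₁ m₂ : MeasurableSpace Ω} {f g : Ω → ℝ}

theorem ProbabilityTheory.Indep.indepFun_of_measurable (h : Indep m₁ m₂ μ) (hf : Measurable[m₁] f)
    (hg : Measurable[m₂] g) : IndepFun f g μ := by
  rw [IndepFun_iff_Indep]
  exact indep_of_indep_of_le_left (indep_of_indep_of_le_right h hg.comap_le) hf.comap_le

theorem ProbabilityTheory.IndepFun.sq (h : IndepFun f g μ) :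
    IndepFun (fun ω => f ω ^ 2) (fun ω => g ω ^ 2) μ :=
  h.comp (measurable_id.pow_const 2) (measurable_id.pow_const 2)

/-- Independence is what keeps the product in L²: the squares are independent and integrable. Hölder
alone would give only L¹. -/
theorem ProbabilityTheory.IndepFun.memLp_two_mul (h : IndepFun f g μ) (hf : MemLp f 2 μ)
    (hg : MemLp g 2 μ) : MemLp (fun ω => f ω * g ω) 2 μ := by
  refine (memLp_two_iff_integrable_sq (hf.1.mul hg.1)).2 ?_
  simp only [Pi.mul_apply, mul_pow]
  exact h.sq.integrable_mul hf.integrable_sq hg.integrable_sq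

theorem ProbabilityTheory.IndepFun.integral_mul_sq (h : IndepFun f g μ) (hf : MemLp f 2 μ)
    (hg : MemLp g 2 μ) :
    ∫ ω, (f ω * g ω) ^ 2 ∂μ = (∫ ω, f ω ^ 2 ∂μ) * ∫ ω, g ω ^ 2 ∂μ := by
  simp only [mul_pow]
  exact h.sq.integral_fun_mul_eq_mul_integral hf.integrable_sq.1 hg.integrable_sq.1

theorem condExp_mul_eq_zero_of_indep [IsProbabilityMeasure μ] (h₁ : m₁ ≤ mΩ) (h₂ : m₂ ≤ mΩ)
    (h : Indep m₁ m₂ μ) (hf : Measurable[m₁] f) (hg : Measurable[m₂] g) (hf2 : MemLp f 2 μ)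
    (hg2 : MemLp g 2 μ) (hg0 : ∫ ω, g ω ∂μ = 0) : μ[fun ω => f ω * g ω | m₁] =ᵐ[μ] 0 := by
  have h1 := condExp_mul_of_stronglyMeasurable_left (μ := μ) hf.stronglyMeasurable
    (hf2.integrable_mul hg2) (hg2.integrable one_le_two)
  have h2 := condExp_indep_eq h₂ h₁ hg.stronglyMeasurable h.symm
  filter_upwards [h1, h2] with ω h1 h2
  rw [show (fun ω => f ω * g ω) = f * g from rfl, h1, Pi.mul_apply, h2, hg0, mul_zero]; rfl

theorem integral_mul_eq_zero_of_condExp [IsProbabilityMeasure μ] (h₁ : m₁ ≤ mΩ)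
    (hf : Measurable[m₁] f) (hf2 : MemLp f 2 μ) (hg2 : MemLp g 2 μ) (hg0 : μ[g | m₁] =ᵐ[μ] 0) :
    ∫ ω, f ω * g ω ∂μ = 0 := by
  have h1 := condExp_mul_of_stronglyMeasurable_left (μ := μ) hf.stronglyMeasurable
    (hf2.integrable_mul hg2) (hg2.integrable one_le_two)
  rw [← integral_condExp h₁ (f := fun ω => f ω * g ω)]
  refine integral_eq_zero_of_ae ?_
  filter_upwards [h1, hg0] with ω h1 h2
  rw [show (fun ω => f ω * g ω) = f * g from rfl, h1, Pi.mul_apply, h2]; simp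

end Product

/-- Square-integrable martingale differences with bounded second moments, weighted by a
square-summable sequence, form an almost surely convergent series. -/
theorem ae_tendsto_sum_martingale_difference {μ : Measure Ω} [IsProbabilityMeasure μ]
    (F : Filtration ℕ mΩ) {ξ : ℕ → Ω → ℝ} (hm : ∀ t, Measurable[F (t + 1)] (ξ t))
    (h2 : ∀ t, MemLp (ξ t) 2 μ) (h0 : ∀ t, μ[ξ t | F t] =ᵐ[μ] 0) {C : ℝ}
    (hC : ∀ t, ∫ ω, ξ t ω ^ 2 ∂μ ≤ C) {α : ℕ → ℝ} (hα : Summable fun t => α t ^ 2) :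
    ∀ᵐ ω ∂μ, ∃ s, Tendsto (fun n => ∑ t ∈ Finset.range n, α t * ξ t ω) atTop (𝓝 s) := by
  let X : ℕ → Ω → ℝ := fun n ω => ∑ t ∈ Finset.range n, α t * ξ t ω
  have hX : ∀ n, X (n + 1) = fun ω => X n ω + α n * ξ n ω := fun n => by
    ext ω; simp [X, Finset.sum_range_succ]
  have hXm : ∀ n, Measurable[F n] (X n) := fun n =>
    Finset.measurable_sum _ fun t ht =>
      (((hm t).mono (F.mono (by have := Finset.mem_range.1 ht; omega)) le_rfl).const_mul (α t))
  have hX2 : ∀ n, MemLp (X n) 2 μ := fun n => memLp_finsetSum _ fun t _ => (h2 t).const_mul (α t)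
  have hC0 : 0 ≤ C := (integral_nonneg fun ω => sq_nonneg (ξ 0 ω)).trans (hC 0)
  -- Martingale increments are orthogonal to the past, so second moments add up.
  have hV : ∀ n, ∫ ω, X n ω ^ 2 ∂μ ≤ C * ∑ t ∈ Finset.range n, α t ^ 2 := by
    intro n
    induction n with
    | zero => simp [X]
    | succ n ih =>
      have h3 : ∀ ω, X (n + 1) ω ^ 2 =
          X n ω ^ 2 + (2 * α n) * (X n ω * ξ n ω) + α n ^ 2 * ξ n ω ^ 2 := fun ω => by
        rw [hX]; ring
      have i1 : Integrable (fun ω => X n ω * ξ n ω) μ := (hX2 n).integrable_mul (h2 n)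
      have i2 := i1.const_mul (2 * α n)
      have i3 : Integrable (fun ω => X n ω ^ 2 + 2 * α n * (X n ω * ξ n ω)) μ := (hX2 n).integrable_sq.add i2
      simp only [h3]
      rw [integral_add i3 ((h2 n).integrable_sq.const_mul _),
        integral_add (hX2 n).integrable_sq i2, integral_const_mul, integral_const_mul,
        integral_mul_eq_zero_of_condExp (F.le n) (hXm n) (hX2 n) (h2 n) (h0 n),
        Finset.sum_range_succ]
      nlinarith [mul_le_mul_of_nonneg_left (hC n) (sq_nonneg (α n))]
  have hsub : Submartingale X F μ := by
    refine submartingale_of_condExp_sub_nonneg_nat (fun n => (hXm n).stronglyMeasurable)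
      (fun n => (hX2 n).integrable one_le_two) fun n => ?_
    have h3 : X (n + 1) - X n = α n • ξ n := by
      rw [hX]; ext ω; simp
    rw [h3]
    filter_upwards [condExp_smul (α n) (ξ n) (F n), h0 n] with ω h4 h5
    rw [h4, Pi.smul_apply, h5]; simp
  refine hsub.exists_ae_tendsto_of_bdd
    (R := (1 + C * ∑' t, α t ^ 2).toNNReal) fun n => ?_
  change eLpNorm (X n) 1 μ ≤ _
  rw [eLpNorm_one_eq_lintegral_enorm,
    ← ofReal_integral_norm_eq_lintegral_enorm ((hX2 n).integrable one_le_two)]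
  refine ENNReal.ofReal_le_ofReal ?_
  -- The convergence theorem asks for an L¹ bound; `|x| ≤ 1 + x ^ 2` derives it from the L² bound.
  have h4 : ∫ ω, ‖X n ω‖ ∂μ ≤ ∫ ω, (1 + X n ω ^ 2) ∂μ :=
    integral_mono ((hX2 n).integrable one_le_two).norm
      ((integrable_const 1).add (hX2 n).integrable_sq) fun ω => by
        simp only [Real.norm_eq_abs]
        nlinarith [sq_nonneg (|X n ω| - 1), sq_abs (X n ω)]
  rw [integral_add (integrable_const 1) (hX2 n).integrable_sq] at h4
  have h5 := mul_le_mul_of_nonneg_left (hα.sum_le_tsum (Finset.range n) fun t _ => sq_nonneg _) hC0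
  simp only [integral_const, probReal_univ, smul_eq_mul, mul_one] at h4
  linarith [hV n]

end Noise

/-! ### Linear stochastic approximation -/

section LinearStochasticApproximation

/-- By Cauchy–Schwarz the first-order term `-2a⟨Tx, Tx - TWx⟩` is nonpositive, so only the term in
`a ^ 2` can increase the norm. No smallness of `a` is needed, hence the moment recursion is valid
from time zero. -/
theorem norm_sq_relaxed_step_le {ι κ : Type*} [Fintype ι] [Fintype κ]
    {W : Matrix ι ι ℝ} (T : (ι → ℝ) →ₗ[ℝ] EuclideanSpace ℝ κ)
    (hTW : ∀ x, ‖T (W.mulVec x)‖ ≤ ‖T x‖) {a : ℝ} (ha : 0 ≤ a) (x : ι → ℝ) :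
    ‖T (x - a • (x - W.mulVec x))‖ ^ 2 ≤ (1 + 4 * a ^ 2) * ‖T x‖ ^ 2 := by
  rw [map_sub, map_smul, map_sub, norm_sub_sq_real, inner_smul_right, inner_sub_right,
    real_inner_self_eq_norm_sq, norm_smul, Real.norm_of_nonneg ha]
  have h1 := real_inner_le_norm (T x) (T (W.mulVec x))
  have h2 := norm_sub_le (T x) (T (W.mulVec x))
  have h3 := hTW x
  have h4 : inner ℝ (T x) (T (W.mulVec x)) ≤ ‖T x‖ ^ 2 := by
    nlinarith [norm_nonneg (T x)]
  have h5 : ‖T x - T (W.mulVec x)‖ ^ 2 ≤ 4 * ‖T x‖ ^ 2 := by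
    nlinarith [norm_nonneg (T x), norm_nonneg (T x - T (W.mulVec x))]
  have h6 := mul_nonneg ha (sub_nonneg.2 h4)
  have h7 := mul_le_mul_of_nonneg_left h5 (sq_nonneg a)
  rw [mul_pow]
  linarith

/-- A discrete Gronwall argument: passing to `1 + V` absorbs the additive term, at the price of the
factor `1 + 2 * K * α t ^ 2`, and the product of these factors converges. -/
theorem bounded_of_le_one_add_mul_sq {V α : ℕ → ℝ} {K : ℝ} (hK : 0 ≤ K) (hV : ∀ t, 0 ≤ V t)
    (hα : Summable fun t => α t ^ 2)
    (h : ∀ t, V (t + 1) ≤ (1 + K * α t ^ 2) * V t + K * α t ^ 2) : ∃ C, ∀ t, V t ≤ C := by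
  have key : ∀ t, 1 + V t ≤ Real.exp ((K + K) * ∑ s ∈ Finset.range t, α s ^ 2) * (1 + V 0) := by
    intro t
    induction t with
    | zero => simp
    | succ t ih =>
      rw [Finset.sum_range_succ, mul_add (K + K), Real.exp_add]
      have h1 := Real.add_one_le_exp ((K + K) * α t ^ 2)
      have h2 : 1 + V (t + 1) ≤ (1 + (K + K) * α t ^ 2) * (1 + V t) := by
        have := h t
        have := mul_nonneg (mul_nonneg hK (sq_nonneg (α t))) (hV t)
        nlinarith [mul_nonneg hK (sq_nonneg (α t))]
      have h3 : 0 ≤ (K + K) * α t ^ 2 := by positivity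
      calc _ ≤ _ := h2
        _ ≤ Real.exp ((K + K) * α t ^ 2) *
            (Real.exp ((K + K) * ∑ s ∈ Finset.range t, α s ^ 2) * (1 + V 0)) :=
          mul_le_mul (by linarith) ih (by linarith [hV t]) (Real.exp_pos _).le
        _ = _ := by ring
  refine ⟨Real.exp ((K + K) * ∑' s, α s ^ 2) * (1 + V 0), fun t => ?_⟩
  have h1 : Real.exp ((K + K) * ∑ s ∈ Finset.range t, α s ^ 2) ≤
      Real.exp ((K + K) * ∑' s, α s ^ 2) :=
    Real.exp_le_exp.2 (mul_le_mul_of_nonneg_left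
      (hα.sum_le_tsum _ fun _ _ => sq_nonneg _) (by linarith))
  have h2 := mul_le_mul_of_nonneg_right h1 (show 0 ≤ 1 + V 0 by linarith [hV 0])
  linarith [key t]

variable {Ω : Type*} {mΩ : MeasurableSpace Ω} {μ : Measure Ω} {ι : Type*} [Fintype ι]

theorem LinearMap.apply_eq_sum_coord [DecidableEq ι] {κ : Type*} [Fintype κ]
    (T : (ι → ℝ) →ₗ[ℝ] EuclideanSpace ℝ κ) (x : ι → ℝ) (k : κ) :
    T x k = ∑ i, T (Pi.single i 1) k * x i := by
  conv_lhs => rw [LinearMap.pi_apply_eq_sum_univ T x]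
  simp only [WithLp.ofLp_sum, Finset.sum_apply, WithLp.ofLp_smul, Pi.smul_apply, smul_eq_mul]
  refine Finset.sum_congr rfl fun i _ => ?_
  have h : (fun j => if i = j then (1 : ℝ) else 0) = Pi.single i 1 := by
    ext j; simp [Pi.single_apply, eq_comm]
  rw [mul_comm, h]

theorem measurable_linearMap_coord {m : MeasurableSpace Ω} {κ : Type*} [Fintype κ]
    (T : (ι → ℝ) →ₗ[ℝ] EuclideanSpace ℝ κ) {x : Ω → ι → ℝ}
    (hx : ∀ i, Measurable[m] fun ω => x ω i) (k : κ) : Measurable[m] fun ω => T (x ω) k := by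
  classical
  rw [funext fun ω => LinearMap.apply_eq_sum_coord T (x ω) k]
  exact Finset.measurable_sum _ fun i _ => (hx i).const_mul _

theorem memLp_linearMap_coord {κ : Type*} [Fintype κ] (T : (ι → ℝ) →ₗ[ℝ] EuclideanSpace ℝ κ)
    {x : Ω → ι → ℝ} (hx : ∀ i, MemLp (fun ω => x ω i) 2 μ) (k : κ) :
    MemLp (fun ω => T (x ω) k) 2 μ := by
  classical
  rw [funext fun ω => LinearMap.apply_eq_sum_coord T (x ω) k]
  exact memLp_finsetSum _ fun i _ => (hx i).const_mul _

theorem integrable_norm_sq_linearMap {κ : Type*} [Fintype κ]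
    (T : (ι → ℝ) →ₗ[ℝ] EuclideanSpace ℝ κ)
    {x : Ω → ι → ℝ} (hx : ∀ i, MemLp (fun ω => x ω i) 2 μ) :
    Integrable (fun ω => ‖T (x ω)‖ ^ 2) μ := by
  simp only [EuclideanSpace.norm_sq_eq, Real.norm_eq_abs, sq_abs]
  exact integrable_finsetSum _ fun k _ => (memLp_linearMap_coord T hx k).integrable_sq

/-- Cross terms of a past-measurable vector with a vector of martingale differences vanish. -/
theorem integrable_inner_linearMap_and_integral_eq_zero [IsProbabilityMeasure μ]
    {m : MeasurableSpace Ω} (hm : m ≤ mΩ) {κ : Type*} [Fintype κ]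
    (T : (ι → ℝ) →ₗ[ℝ] EuclideanSpace ℝ κ) {g x : Ω → ι → ℝ}
    (hgm : ∀ i, Measurable[m] fun ω => g ω i) (hg : ∀ i, MemLp (fun ω => g ω i) 2 μ)
    (hx : ∀ i, MemLp (fun ω => x ω i) 2 μ) (hx0 : ∀ i, μ[fun ω => x ω i | m] =ᵐ[μ] 0) :
    Integrable (fun ω => inner ℝ (T (g ω)) (T (x ω))) μ ∧
      ∫ ω, inner ℝ (T (g ω)) (T (x ω)) ∂μ = 0 := by
  classical
  have h1 : ∀ ω, inner ℝ (T (g ω)) (T (x ω)) =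
      ∑ k, ∑ i, T (Pi.single i 1) k * (T (g ω) k * x ω i) := by
    intro ω
    rw [PiLp.inner_apply]
    refine Finset.sum_congr rfl fun k _ => ?_
    rw [LinearMap.apply_eq_sum_coord T (x ω)]
    simp only [RCLike.inner_apply, conj_trivial, Finset.sum_mul]
    exact Finset.sum_congr rfl fun i _ => by ring
  have h2 : ∀ k i, Integrable (fun ω => T (Pi.single i 1) k * (T (g ω) k * x ω i)) μ :=
    fun k i => ((memLp_linearMap_coord T hg k).integrable_mul (hx i)).const_mul _
  simp only [h1]
  refine ⟨integrable_finsetSum _ fun k _ => integrable_finsetSum _ fun i _ => h2 k i, ?_⟩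
  rw [integral_finsetSum _ fun k _ => integrable_finsetSum _ fun i _ => h2 k i]
  refine Finset.sum_eq_zero fun k _ => ?_
  rw [integral_finsetSum _ fun i _ => h2 k i]
  refine Finset.sum_eq_zero fun i _ => ?_
  rw [integral_const_mul, integral_mul_eq_zero_of_condExp hm (measurable_linearMap_coord T hgm k)
    (memLp_linearMap_coord T hg k) (hx i) (hx0 i), mul_zero]

/-- Almost sure convergence to zero of a linear stochastic approximation scheme with
multiplicative and additive noise. -/
theorem ae_tendsto_zero_of_linear_stochastic_approximation [IsProbabilityMeasure μ]
    [DecidableEq ι] {W : Matrix ι ι ℝ}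
    (hρ : spectralRadius ℂ (W.map (algebraMap ℝ ℂ)) < 1)
    {G : ℕ → MeasurableSpace Ω} (hG : ∀ t, G t ≤ mΩ)
    (hind : ∀ t, Indep (pastFiltration G hG t) (G t) μ)
    {D : ι → ι → ℕ → Ω → ℝ} {d : ι → ℕ → Ω → ℝ} (hD : ∀ i n, IsNoise G μ (D i n))
    (hd : ∀ i, IsNoise G μ (d i)) {α : ℕ → ℝ} (hα : ∀ t, 0 < α t)
    (hα_sum : Tendsto (fun n => ∑ t ∈ Finset.range n, α t) atTop atTop)
    (hα_sq : Summable fun t => α t ^ 2) {y : ℕ → Ω → ι → ℝ} {y₀ : ι → ℝ} (hy0 : ∀ ω, y 0 ω = y₀)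
    (hy : ∀ t ω, y (t + 1) ω = y t ω - α t • (y t ω - W.mulVec (y t ω)
      - fun i => ∑ n, D i n t ω * y t ω n + d i t ω)) :
    ∀ᵐ ω ∂μ, Tendsto (fun t => y t ω) atTop (𝓝 0) := by
  obtain ⟨N, T, c, hc0, hc1, hTW, hT⟩ := exists_contracting_embedding W hρ
  have hTW' : ∀ x, ‖T (W.mulVec x)‖ ≤ ‖T x‖ := fun x =>
    (hTW x).trans (mul_le_of_le_one_left (norm_nonneg _) hc1.le)
  let F := pastFiltration G hG
  let ξ : ℕ → Ω → ι → ℝ := fun t ω i => ∑ n, y t ω n * D i n t ω + d i t ω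
  have hy' : ∀ t ω, y (t + 1) ω =
      (y t ω - α t • (y t ω - W.mulVec (y t ω))) + α t • ξ t ω := by
    intro t ω
    rw [hy]
    ext i
    simp only [ξ, Pi.add_apply, Pi.sub_apply, Pi.smul_apply, smul_eq_mul, mul_comm (y t ω _)]
    ring
  have stepMeas : ∀ (m : MeasurableSpace Ω) t, (∀ i, Measurable[m] fun ω => y t ω i) →
      ∀ i, Measurable[m] fun ω => (y t ω - α t • (y t ω - W.mulVec (y t ω))) i := by
    intro m t h i
    simp only [Pi.sub_apply, Pi.smul_apply, smul_eq_mul, Matrix.mulVec, dotProduct]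
    exact (h i).sub (((h i).sub
      (Finset.measurable_sum _ fun n _ => (h n).const_mul _)).const_mul _)
  have stepLp : ∀ t, (∀ i, MemLp (fun ω => y t ω i) 2 μ) →
      ∀ i, MemLp (fun ω => (y t ω - α t • (y t ω - W.mulVec (y t ω))) i) 2 μ := by
    intro t h i
    simp only [Pi.sub_apply, Pi.smul_apply, smul_eq_mul, Matrix.mulVec, dotProduct]
    exact (h i).sub (((h i).sub
      (memLp_finsetSum _ fun n _ => (h n).const_mul _)).const_mul _)
  have hξm : ∀ t, (∀ i, Measurable[F t] fun ω => y t ω i) →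
      ∀ i, Measurable[F (t + 1)] fun ω => ξ t ω i := fun t h i =>
    (Finset.measurable_sum _ fun n _ => ((h n).mono (F.mono t.le_succ) le_rfl).mul
      (((hD i n).measurable t).mono (le_pastFiltration_succ G hG t) le_rfl)).add
      (((hd i).measurable t).mono (le_pastFiltration_succ G hG t) le_rfl)
  have hprod : ∀ t i n, Measurable[F t] (fun ω => y t ω n) →
      IndepFun (fun ω => y t ω n) (D i n t) μ := fun t i n h =>
    (hind t).indepFun_of_measurable h ((hD i n).measurable t)
  have hξLp : ∀ t, (∀ i, Measurable[F t] fun ω => y t ω i) → (∀ i, MemLp (fun ω => y t ω i) 2 μ) →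
      ∀ i, MemLp (fun ω => ξ t ω i) 2 μ := fun t h h' i =>
    (memLp_finsetSum _ fun n _ =>
      (hprod t i n (h n)).memLp_two_mul (h' n) ((hD i n).memLp t)).add ((hd i).memLp t)
  -- Both properties are proved together: square integrability of the multiplicative noise relies on
  -- independence of `y t` and `D i n t`, hence on measurability of `y t` for the strict past. At
  -- time zero that past is trivial, which is where the deterministic start enters.
  have hyF : ∀ t, (∀ i, Measurable[F t] fun ω => y t ω i) ∧ ∀ i, MemLp (fun ω => y t ω i) 2 μ := by
    intro t
    induction t with
    | zero => simp only [hy0]; exact ⟨fun i => measurable_const, fun i => memLp_const _⟩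
    | succ t ih =>
      simp only [hy', Pi.add_apply, Pi.smul_apply _ (ξ t _), smul_eq_mul]
      exact ⟨fun i => (stepMeas _ t (fun i => (ih.1 i).mono (F.mono t.le_succ) le_rfl) i).add
        ((hξm t ih.1 i).const_mul _), fun i => (stepLp t ih.2 i).add
        ((hξLp t ih.1 ih.2 i).const_mul _)⟩
  have hym := fun t => (hyF t).1
  have hyLp := fun t => (hyF t).2
  have hξ0 : ∀ t i, μ[fun ω => ξ t ω i | F t] =ᵐ[μ] 0 := by
    intro t i
    have h1 : ∀ n, μ[fun ω => y t ω n * D i n t ω | F t] =ᵐ[μ] 0 := fun n =>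
      condExp_mul_eq_zero_of_indep (F.le t) (hG t) (hind t) (hym t n) ((hD i n).measurable t)
        (hyLp t n) ((hD i n).memLp t) ((hD i n).integral_eq_zero t)
    have h2 : μ[d i t | F t] =ᵐ[μ] 0 := by
      have := condExp_indep_eq (hG t) (F.le t) ((hd i).measurable t).stronglyMeasurable
        (hind t).symm
      rw [(hd i).integral_eq_zero t] at this
      exact this
    have i1 : ∀ n, Integrable (fun ω => y t ω n * D i n t ω) μ := fun n =>
      (hyLp t n).integrable_mul ((hD i n).memLp t)
    have h3 : (fun ω => ξ t ω i) = (∑ n, fun ω => y t ω n * D i n t ω) + d i t := by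
      ext ω; simp [ξ]
    have h4 := condExp_add (m := F t) (integrable_finsetSum' Finset.univ fun n _ => i1 n)
      (((hd i).memLp t).integrable one_le_two)
    have h5 := condExp_finsetSum (m := F t) (s := Finset.univ) (fun n _ => i1 n)
    rw [h3]
    filter_upwards [h4, h5, h2, ae_all_iff.2 h1] with ω h4 h5 h2 h1
    rw [h4, Pi.add_apply, h5, h2, Finset.sum_apply]
    simp [h1]
  choose cD hcD using fun i n => (hD i n).bdd
  choose cd hcd using fun i => (hd i).bdd
  have hcD0 : ∀ i n, 0 ≤ cD i n := fun i n => (integral_nonneg fun ω => sq_nonneg _).trans (hcD i n 0)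
  have hcd0 : ∀ i, 0 ≤ cd i := fun i => (integral_nonneg fun ω => sq_nonneg _).trans (hcd i 0)
  let V : ℕ → ℝ := fun t => ∫ ω, ‖T (y t ω)‖ ^ 2 ∂μ
  have hV0 : ∀ t, 0 ≤ V t := fun t => integral_nonneg fun ω => sq_nonneg _
  have hyV : ∀ t n, ∫ ω, y t ω n ^ 2 ∂μ ≤ 4 * V t := by
    intro t n
    rw [← integral_const_mul]
    refine integral_mono (hyLp t n).integrable_sq
      ((integrable_norm_sq_linearMap T (hyLp t)).const_mul 4) fun ω => ?_
    have := pow_le_pow_left₀ (abs_nonneg _) (hT (y t ω) n) 2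
    rw [sq_abs, mul_pow] at this
    norm_num at this
    exact this
  -- The second moment of `y t ω n * D i n t ω` factorizes by independence; the first factor is at
  -- most `4 * V t` and the second is bounded uniformly in time.
  obtain ⟨Q, hQ0, hQ⟩ : ∃ Q : ℝ, 0 ≤ Q ∧ ∀ t i, ∫ ω, ξ t ω i ^ 2 ∂μ ≤ Q * (1 + V t) := by
    let q : ι → ℝ := fun i => 2 * (Fintype.card ι * ∑ n, cD i n * 4) + 2 * cd i
    have hq : ∀ i, 0 ≤ q i := fun i => by
      have := Finset.sum_nonneg fun n (_ : n ∈ Finset.univ) => mul_nonneg (hcD0 i n) zero_le_four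
      have := hcd0 i
      positivity
    refine ⟨∑ i, q i, Finset.sum_nonneg fun i _ => hq i, fun t i => ?_⟩
    have i1 : ∀ n, Integrable (fun ω => (y t ω n * D i n t ω) ^ 2) μ := fun n =>
      ((hprod t i n (hym t n)).memLp_two_mul (hyLp t n) ((hD i n).memLp t)).integrable_sq
    have i2 : Integrable (fun ω => 2 * (Fintype.card ι * ∑ n, (y t ω n * D i n t ω) ^ 2)) μ :=
      ((integrable_finsetSum _ fun n _ => i1 n).const_mul _).const_mul _
    have i3 : Integrable (fun ω => 2 * d i t ω ^ 2) μ := ((hd i).memLp t).integrable_sq.const_mul _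
    have h1 : ∫ ω, ξ t ω i ^ 2 ∂μ ≤ ∫ ω, (2 * (Fintype.card ι * ∑ n, (y t ω n * D i n t ω) ^ 2)
        + 2 * d i t ω ^ 2) ∂μ := by
      refine integral_mono (hξLp t (hym t) (hyLp t) i).integrable_sq (i2.add i3) fun ω => ?_
      have h2 := sq_sum_le_card_mul_sum_sq (s := Finset.univ) (f := fun n => y t ω n * D i n t ω)
      rw [Finset.card_univ] at h2
      simp only [ξ]
      nlinarith [sq_nonneg (∑ n, y t ω n * D i n t ω - d i t ω)]
    rw [integral_add i2 i3, integral_const_mul, integral_const_mul, integral_const_mul,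
      integral_finsetSum _ fun n _ => i1 n] at h1
    have h2 : ∑ n, ∫ ω, (y t ω n * D i n t ω) ^ 2 ∂μ ≤ ∑ n, cD i n * 4 * V t := by
      refine Finset.sum_le_sum fun n _ => ?_
      rw [(hprod t i n (hym t n)).integral_mul_sq (hyLp t n) ((hD i n).memLp t)]
      have := mul_le_mul (hyV t n) (hcD i n t) (integral_nonneg fun ω => sq_nonneg _)
        (by linarith [hV0 t])
      linarith
    rw [← Finset.sum_mul] at h2
    have h3 : q i ≤ ∑ i, q i := Finset.single_le_sum (fun i _ => hq i) (Finset.mem_univ i)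
    have h4 : ∫ ω, ξ t ω i ^ 2 ∂μ ≤ q i * (1 + V t) := by
      have h5 := mul_le_mul_of_nonneg_left h2 (Nat.cast_nonneg (α := ℝ) (Fintype.card ι))
      have h6 := hcd i t
      have h7 : 0 ≤ (Fintype.card ι : ℝ) * ∑ n, cD i n * 4 := mul_nonneg (Nat.cast_nonneg _)
        (Finset.sum_nonneg fun n _ => mul_nonneg (hcD0 i n) zero_le_four)
      have h8 := mul_nonneg (hcd0 i) (hV0 t)
      simp only [q]
      nlinarith
    exact h4.trans (mul_le_mul_of_nonneg_right h3 (by linarith [hV0 t]))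
  obtain ⟨K, hK0, hK⟩ := LinearMap.exists_norm_sq_le_sum_sq T
  -- Expanding the square leaves the drift, the noise energy and a cross term that integrates to
  -- zero.
  have hVrec : ∀ t, V (t + 1) ≤ (1 + 4 * α t ^ 2) * V t +
      α t ^ 2 * (K * (Fintype.card ι * (Q * (1 + V t)))) := by
    intro t
    have hξt := hξLp t (hym t) (hyLp t)
    obtain ⟨i1, h1⟩ := integrable_inner_linearMap_and_integral_eq_zero (F.le t) T
      (stepMeas _ t (hym t)) (stepLp t (hyLp t)) hξt (hξ0 t)
    have i2 := (integrable_norm_sq_linearMap T (hyLp t)).const_mul (1 + 4 * α t ^ 2)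
    have i3 := i1.const_mul (2 * α t)
    have i4 : Integrable (fun ω => α t ^ 2 * (K * ∑ i, ξ t ω i ^ 2)) μ :=
      ((integrable_finsetSum _ fun i _ => (hξt i).integrable_sq).const_mul K).const_mul _
    have i5 : Integrable (fun ω => (1 + 4 * α t ^ 2) * ‖T (y t ω)‖ ^ 2 + 2 * α t *
      inner ℝ (T (y t ω - α t • (y t ω - W.mulVec (y t ω)))) (T (ξ t ω))) μ := i2.add i3
    have h2 : V (t + 1) ≤ ∫ ω, ((1 + 4 * α t ^ 2) * ‖T (y t ω)‖ ^ 2 + 2 * α t *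
        inner ℝ (T (y t ω - α t • (y t ω - W.mulVec (y t ω)))) (T (ξ t ω))
        + α t ^ 2 * (K * ∑ i, ξ t ω i ^ 2)) ∂μ := by
      refine integral_mono (integrable_norm_sq_linearMap T (hyLp (t + 1))) (i5.add i4) fun ω => ?_
      simp only
      rw [hy', map_add, norm_add_sq_real, map_smul, inner_smul_right, norm_smul,
        Real.norm_of_nonneg (hα t).le, mul_pow]
      have h3 := norm_sq_relaxed_step_le T hTW' (hα t).le (y t ω)
      have h4 := mul_le_mul_of_nonneg_left (hK (ξ t ω)) (sq_nonneg (α t))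
      linarith
    rw [integral_add i5 i4, integral_add i2 i3, integral_const_mul, integral_const_mul, h1,
      integral_const_mul, integral_const_mul,
      integral_finsetSum _ fun i _ => (hξt i).integrable_sq] at h2
    have h3 : ∑ i, ∫ ω, ξ t ω i ^ 2 ∂μ ≤ Fintype.card ι * (Q * (1 + V t)) := by
      refine (Finset.sum_le_sum fun i _ => hQ t i).trans ?_
      simp
    have h4 := mul_le_mul_of_nonneg_left (mul_le_mul_of_nonneg_left h3 hK0) (sq_nonneg (α t))
    simp only [V] at *
    linarith
  obtain ⟨C, hC⟩ : ∃ C, ∀ t, V t ≤ C := by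
    have hE : 0 ≤ K * (Fintype.card ι * Q) := by positivity
    refine bounded_of_le_one_add_mul_sq (K := 4 + K * (Fintype.card ι * Q)) (by linarith) hV0
      hα_sq fun t => (hVrec t).trans ?_
    nlinarith [sq_nonneg (α t)]
  have hconv : ∀ i, ∀ᵐ ω ∂μ, ∃ s,
      Tendsto (fun n => ∑ t ∈ Finset.range n, α t * ξ t ω i) atTop (𝓝 s) := fun i =>
    ae_tendsto_sum_martingale_difference F (fun t => hξm t (hym t) i)
      (fun t => hξLp t (hym t) (hyLp t) i) (fun t => hξ0 t i) (C := Q * (1 + C))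
      (fun t => (hQ t i).trans (mul_le_mul_of_nonneg_left (by linarith [hC t]) hQ0)) hα_sq
  have hα0 : Tendsto α atTop (𝓝 0) := by
    have := hα_sq.tendsto_atTop_zero.sqrt
    simpa only [Real.sqrt_sq (hα _).le, Real.sqrt_zero] using this
  filter_upwards [ae_all_iff.2 hconv] with ω hω
  refine tendsto_zero_of_summable_perturbation T hc1 hTW hT hα hα_sum hα0 (ξ := fun t => ξ t ω)
    (fun t => ?_) hω
  rw [hy']
  module

end LinearStochasticApproximation

/-! ### Combining independent families -/

section Independence

theorem iIndep_sumElim {Ω : Type*} {mΩ : MeasurableSpace Ω} {μ : Measure Ω} {ι κ : Type*}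
    {m₁ : ι → MeasurableSpace Ω} {m₂ : κ → MeasurableSpace Ω} (h₁ : iIndep m₁ μ)
    (h₂ : iIndep m₂ μ) (h : Indep (⨆ i, m₁ i) (⨆ k, m₂ k) μ) : iIndep (Sum.elim m₁ m₂) μ := by
  rw [iIndep_iff]
  intro s f hf
  have hl : ∀ i ∈ s.toLeft, MeasurableSet[m₁ i] (f (Sum.inl i)) := fun i hi =>
    hf _ (Finset.mem_toLeft.1 hi)
  have hr : ∀ k ∈ s.toRight, MeasurableSet[m₂ k] (f (Sum.inr k)) := fun k hk =>
    hf _ (Finset.mem_toRight.1 hk)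
  have hs : ⋂ i ∈ s, f i =
      (⋂ i ∈ s.toLeft, f (Sum.inl i)) ∩ ⋂ k ∈ s.toRight, f (Sum.inr k) := by
    ext ω; simp
  have hprod : ∏ i ∈ s, μ (f i) =
      (∏ i ∈ s.toLeft, μ (f (Sum.inl i))) * ∏ k ∈ s.toRight, μ (f (Sum.inr k)) := by
    conv_lhs => rw [← Finset.toLeft_disjSum_toRight (u := s)]
    rw [Finset.prod_disjSum]
  rw [hs, hprod, ← (iIndep_iff _ _).1 h₁ _ hl, ← (iIndep_iff _ _).1 h₂ _ hr]
  refine (Indep_iff _ _ _).1 h _ _ ?_ ?_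
  · exact Finset.measurableSet_biInter _ fun i hi => le_iSup m₁ i _ (hl i hi)
  · exact Finset.measurableSet_biInter _ fun k hk => le_iSup m₂ k _ (hr k hk)

theorem comap_pi_eq_iSup {Ω ι : Type*} {β : ι → Type*} [∀ i, MeasurableSpace (β i)]
    (f : ∀ i, Ω → β i) :
    MeasurableSpace.comap (fun ω i => f i ω) inferInstance =
      ⨆ i, MeasurableSpace.comap (f i) inferInstance := by
  change MeasurableSpace.comap _ (⨆ i, _) = _
  simp only [MeasurableSpace.comap_iSup, MeasurableSpace.comap_comp]
  rfl

end Independence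

/-! ### The random environment as noise adapted to independent innovations -/

namespace DLRE

namespace RandomEnvironment

variable {m M : ℕ} {net : SensorNetwork m M} {Ω : Type*} [mΩ : MeasurableSpace Ω] {μ : Measure Ω}
  (env : RandomEnvironment net μ)

/-- The `σ`-algebra of the measurement errors at time `t`. -/
def errAlgebra (t : ℕ) : MeasurableSpace Ω :=
  MeasurableSpace.comap (fun ω => ((fun l k => env.errB t ω l k, fun l n => env.errP t ω l n) :
      (Fin M → Fin (m + 1) → ℝ) × (Fin M → Fin M → ℝ))) inferInstance

/-- The `σ`-algebra of the link states at time `t`. -/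
def linkAlgebra (t : ℕ) : MeasurableSpace Ω :=
  MeasurableSpace.comap (fun ω (p : net.Link) => env.e p.1.1 p.1.2 t ω) inferInstance

/-- The `σ`-algebra of a single channel noise variable. -/
def channelAlgebra (i : net.Link × Fin m × ℕ) : MeasurableSpace Ω :=
  MeasurableSpace.comap (fun ω => env.v i.1.1.1 i.1.1.2 i.2.1 i.2.2 ω) inferInstance

/-- All elementary sources of randomness. -/
def source : ℕ ⊕ ℕ ⊕ (net.Link × Fin m × ℕ) → MeasurableSpace Ω :=
  Sum.elim env.errAlgebra (Sum.elim env.linkAlgebra env.channelAlgebra)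

theorem errAlgebra_le (t : ℕ) : env.errAlgebra t ≤ mΩ :=
  Measurable.comap_le <| (measurable_pi_lambda _ fun l => measurable_pi_lambda _ fun k =>
    env.errB_measurable t l k).prodMk (measurable_pi_lambda _ fun l => measurable_pi_lambda _
      fun n => env.errP_measurable t l n)

theorem linkAlgebra_le (t : ℕ) : env.linkAlgebra t ≤ mΩ :=
  Measurable.comap_le <| measurable_pi_lambda _ fun p => env.e_measurable _ _ p.2 t

theorem channelAlgebra_le (i : net.Link × Fin m × ℕ) : env.channelAlgebra i ≤ mΩ :=
  Measurable.comap_le <| env.v_measurable _ _ i.1.2 _ _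

theorem source_le (i : ℕ ⊕ ℕ ⊕ (net.Link × Fin m × ℕ)) : env.source i ≤ mΩ := by
  rcases i with t | t | i
  exacts [env.errAlgebra_le t, env.linkAlgebra_le t, env.channelAlgebra_le i]

theorem iIndep_sources :
    iIndep ![⨆ t, env.errAlgebra t, ⨆ t, env.linkAlgebra t, ⨆ i, env.channelAlgebra i] μ := by
  have h := env.indep
  rw [comap_pi_eq_iSup, comap_pi_eq_iSup, comap_pi_eq_iSup] at h
  have hlink : ⨆ t, env.linkAlgebra t = ⨆ i : net.Link × ℕ,
      MeasurableSpace.comap (env.e i.1.1.1 i.1.1.2 i.2) inferInstance := by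
    simp only [linkAlgebra, comap_pi_eq_iSup, iSup_prod]
    rw [iSup_comm]
  rw [hlink]
  exact h

/-- Independence inside each family is glued to independence between the families. Errors and link
states are bundled by time, since they may be dependent at a common time, while channel noises enter
one by one. -/
theorem iIndep_source : iIndep env.source μ := by
  have h := env.iIndep_sources
  have hle : ∀ i, (![⨆ t, env.errAlgebra t, ⨆ t, env.linkAlgebra t, ⨆ i, env.channelAlgebra i] :
      Fin 3 → MeasurableSpace Ω) i ≤ mΩ := by
    intro i
    fin_cases i
    exacts [iSup_le env.errAlgebra_le, iSup_le env.linkAlgebra_le, iSup_le env.channelAlgebra_le]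
  refine iIndep_sumElim env.err_indep.iIndep (iIndep_sumElim env.e_indep.iIndep env.v_indep.iIndep
    (h.indep (i := 1) (j := 2) (by decide))) ?_
  have h2 := indep_iSup_of_disjoint hle h (S := {0}) (T := {1, 2}) (by simp)
  rw [iSup_singleton, iSup_pair] at h2
  rw [iSup_sum]
  exact h2

/-- The time index of a source of randomness. -/
def sourceTime : ℕ ⊕ ℕ ⊕ (net.Link × Fin m × ℕ) → ℕ :=
  Sum.elim id (Sum.elim id fun i => i.2.2)

/-- The `σ`-algebra of all random variables revealed at time `t`. -/
def innovation (t : ℕ) : MeasurableSpace Ω :=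
  ⨆ i ∈ {i | sourceTime (net := net) i = t}, env.source i

theorem innovation_le (t : ℕ) : env.innovation t ≤ mΩ := iSup₂_le fun i _ => env.source_le i

/-- The past and the present are generated by sources with disjoint index sets, namely those of time
below `t` and those of time exactly `t`. -/
theorem indep_pastFiltration_innovation (t : ℕ) :
    Indep (pastFiltration env.innovation env.innovation_le t) (env.innovation t) μ := by
  have h := indep_iSup_of_disjoint env.source_le env.iIndep_source
    (S := {i | sourceTime (net := net) i < t}) (T := {i | sourceTime (net := net) i = t})
    (Set.disjoint_left.2 fun i h1 h2 => (ne_of_lt h1) h2)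
  refine indep_of_indep_of_le_left h (iSup₂_le fun s hs => iSup₂_le fun i hi => ?_)
  exact le_iSup₂_of_le (f := fun i (_ : i ∈ {i | sourceTime (net := net) i < t}) => env.source i)
    i (by rw [Set.mem_ofPred_eq] at hi ⊢; rw [hi]; exact hs) le_rfl

theorem source_le_innovation (i : ℕ ⊕ ℕ ⊕ (net.Link × Fin m × ℕ)) :
    env.source i ≤ env.innovation (sourceTime i) :=
  le_iSup₂_of_le
    (f := fun k (_ : k ∈ {k | sourceTime (net := net) k = sourceTime i}) => env.source k) i rfl le_rfl

/-- The zero-mean measurement error of the coefficient of node `n` at sensor `l`. -/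
def err (l : Fin M) (n : Node m M) (t : ℕ) (ω : Ω) : ℝ :=
  Sum.elim (env.errB t ω l) (env.errP t ω l) n

/-- The mean of the measured coefficient of node `n` at sensor `l`. -/
noncomputable def meanCoeff (l : Fin M) (n : Node m M) : ℝ :=
  Sum.elim ((net.B + env.SB) l) ((net.P + env.SP) l) n

theorem measurable_err (l : Fin M) (n : Node m M) (t : ℕ) :
    Measurable[env.errAlgebra t] (env.err l n t) := by
  have h := comap_measurable (m := inferInstance) (fun ω => ((fun l k => env.errB t ω l k, fun l n => env.errP t ω l n) :
      (Fin M → Fin (m + 1) → ℝ) × (Fin M → Fin M → ℝ)))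
  rcases n with k | n
  · exact (((measurable_pi_apply k).comp (measurable_pi_apply l)).comp measurable_fst).comp h
  · exact (((measurable_pi_apply n).comp (measurable_pi_apply l)).comp measurable_snd).comp h

theorem measurable_e {l : Fin M} {n : Node m M} (hn : n ∈ net.Θ l) (t : ℕ) :
    Measurable[env.linkAlgebra t] (env.e l n t) :=
  (measurable_pi_apply (⟨(l, n), hn⟩ : net.Link)).comp
    (comap_measurable fun ω (p : net.Link) => env.e p.1.1 p.1.2 t ω)

theorem measurable_v {l : Fin M} {n : Node m M} (hn : n ∈ net.Θ l) (j : Fin m) (t : ℕ) :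
    Measurable[env.channelAlgebra (⟨(l, n), hn⟩, j, t)] (env.v l n j t) :=
  comap_measurable _

theorem errAlgebra_le_innovation (t : ℕ) : env.errAlgebra t ≤ env.innovation t :=
  env.source_le_innovation (Sum.inl t)

theorem linkAlgebra_le_innovation (t : ℕ) : env.linkAlgebra t ≤ env.innovation t :=
  env.source_le_innovation (Sum.inr (Sum.inl t))

theorem channelAlgebra_le_innovation (i : net.Link × Fin m × ℕ) :
    env.channelAlgebra i ≤ env.innovation i.2.2 :=
  env.source_le_innovation (Sum.inr (Sum.inr i))

theorem indep_err_link (t : ℕ) : Indep (env.errAlgebra t) (env.linkAlgebra t) μ :=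
  env.iIndep_source.indep (i := Sum.inl t) (j := Sum.inr (Sum.inl t)) (by simp)

theorem indep_err_link_channel (t : ℕ) (i : net.Link × Fin m × ℕ) :
    Indep (env.errAlgebra t ⊔ env.linkAlgebra t) (env.channelAlgebra i) μ := by
  have h := indep_iSup_of_disjoint env.source_le env.iIndep_source
    (S := {Sum.inl t, Sum.inr (Sum.inl t)}) (T := {Sum.inr (Sum.inr i)}) (by simp)
  rw [iSup_singleton, iSup_pair] at h
  exact h

theorem isNoise_err (l : Fin M) (n : Node m M) : IsNoise env.innovation μ (env.err l n) where
  measurable t := (env.measurable_err l n t).mono (env.errAlgebra_le_innovation t) le_rfl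
  memLp t := by
    rcases n with k | n
    exacts [env.errB_memLp t l k, env.errP_memLp t l n]
  integral_eq_zero t := by
    rcases n with k | n
    exacts [env.errB_mean t l k, env.errP_mean t l n]
  bdd := by
    rcases n with k | n
    · obtain ⟨c, hc⟩ := env.errB_bound
      refine ⟨c, fun t => le_trans ?_ (hc t)⟩
      refine integral_mono (env.errB_memLp t l k).integrable_sq (integrable_finsetSum _ fun l _ =>
        integrable_finsetSum _ fun k _ => (env.errB_memLp t l k).integrable_sq) fun ω => ?_
      refine le_trans (Finset.single_le_sum (f := fun k => env.errB t ω l k ^ 2)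
        (fun _ _ => sq_nonneg _) (Finset.mem_univ k)) ?_
      exact Finset.single_le_sum (f := fun l => ∑ k, env.errB t ω l k ^ 2)
        (fun _ _ => Finset.sum_nonneg fun _ _ => sq_nonneg _) (Finset.mem_univ l)
    · obtain ⟨c, hc⟩ := env.errP_bound
      refine ⟨c, fun t => le_trans ?_ (hc t)⟩
      refine integral_mono (env.errP_memLp t l n).integrable_sq (integrable_finsetSum _ fun l _ =>
        integrable_finsetSum _ fun k _ => (env.errP_memLp t l k).integrable_sq) fun ω => ?_
      refine le_trans (Finset.single_le_sum (f := fun k => env.errP t ω l k ^ 2)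
        (fun _ _ => sq_nonneg _) (Finset.mem_univ n)) ?_
      exact Finset.single_le_sum (f := fun l => ∑ k, env.errP t ω l k ^ 2)
        (fun _ _ => Finset.sum_nonneg fun _ _ => sq_nonneg _) (Finset.mem_univ l)

theorem integral_e [IsProbabilityMeasure μ] {l : Fin M} {n : Node m M} (hn : n ∈ net.Θ l)
    (t : ℕ) : ∫ ω, env.e l n t ω ∂μ = env.q l n := by
  have h1 : env.e l n t = Set.indicator {ω | env.e l n t ω = 1} 1 := by
    ext ω
    rcases env.e_binary l n hn t ω with h | h <;> simp [Set.indicator, h]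
  have h2 : MeasurableSet {ω | env.e l n t ω = 1} :=
    env.e_measurable l n hn t (measurableSet_singleton 1)
  rw [h1, integral_indicator_one h2, Measure.real, env.e_prob l n hn t,
    ENNReal.toReal_ofReal (env.q_pos l n hn).le]

theorem abs_e_div_q_le {l : Fin M} {n : Node m M} (hn : n ∈ net.Θ l) (t : ℕ) (ω : Ω) :
    |env.e l n t ω / env.q l n| ≤ 1 / env.q l n ∧
      |env.e l n t ω / env.q l n - 1| ≤ 1 / env.q l n := by
  have h0 := env.q_pos l n hn
  have h1 := one_le_one_div h0 (env.q_le_one l n hn)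
  have h2 : 0 < 1 / env.q l n := by positivity
  rcases env.e_binary l n hn t ω with h | h
  · rw [h]; simp; simp at h1; exact ⟨h0.le, h1⟩
  · rw [h, abs_of_pos h2, abs_of_nonneg (by linarith)]
    exact ⟨le_rfl, by linarith⟩

theorem integral_sq_le_of_abs_le [IsProbabilityMeasure μ] {g : Ω → ℝ} {a : ℝ}
    (hg : MemLp g 2 μ) (ha : ∀ ω, |g ω| ≤ a) : ∫ ω, g ω ^ 2 ∂μ ≤ a ^ 2 := by
  have h : ∫ ω, g ω ^ 2 ∂μ ≤ ∫ _, a ^ 2 ∂μ :=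
    integral_mono hg.integrable_sq (integrable_const _) fun ω =>
      sq_le_sq' (neg_le_of_abs_le (ha ω)) (le_of_abs_le (ha ω))
  simpa using h

theorem memLp_meanCoeff_add_err [IsProbabilityMeasure μ] (l : Fin M) (n : Node m M) (t : ℕ) :
    MemLp (fun ω => env.meanCoeff l n + env.err l n t ω) 2 μ :=
  (memLp_const (env.meanCoeff l n)).add (f := fun _ => env.meanCoeff l n)
    ((env.isNoise_err l n).memLp t)

theorem exists_integral_meanCoeff_add_err_sq_le [IsProbabilityMeasure μ] (l : Fin M)
    (n : Node m M) :
    ∃ c : ℝ, 0 ≤ c ∧ ∀ t, ∫ ω, (env.meanCoeff l n + env.err l n t ω) ^ 2 ∂μ ≤ c := by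
  have hε := env.isNoise_err l n
  obtain ⟨c, hc⟩ := hε.bdd
  have hc0 : 0 ≤ c := (integral_nonneg fun ω => sq_nonneg _).trans (hc 0)
  refine ⟨2 * env.meanCoeff l n ^ 2 + 2 * c, by positivity, fun t => ?_⟩
  have h1 : ∫ ω, (env.meanCoeff l n + env.err l n t ω) ^ 2 ∂μ ≤
      ∫ ω, (2 * env.meanCoeff l n ^ 2 + 2 * env.err l n t ω ^ 2) ∂μ :=
    integral_mono (env.memLp_meanCoeff_add_err l n t).integrable_sq
      ((integrable_const _).add ((hε.memLp t).integrable_sq.const_mul 2)) fun ω => by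
        have := sq_nonneg (env.meanCoeff l n - env.err l n t ω)
        simp only
        linarith
  rw [integral_add (integrable_const _) ((hε.memLp t).integrable_sq.const_mul 2),
    integral_const] at h1
  simp only [probReal_univ, smul_eq_mul, one_mul] at h1
  rw [integral_const_mul] at h1
  linarith [hc t]

/-- The coefficient fluctuation caused by failures of one link. -/
theorem isNoise_link_failure [IsProbabilityMeasure μ] {l : Fin M} {n : Node m M}
    (hn : n ∈ net.Θ l) : IsNoise env.innovation μ fun t ω =>
      (env.meanCoeff l n + env.err l n t ω) * (env.e l n t ω / env.q l n - 1) := by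
  have hfm : ∀ t, Measurable[env.errAlgebra t] fun ω => env.meanCoeff l n + env.err l n t ω :=
    fun t => (env.measurable_err l n t).const_add _
  have hgm : ∀ t, Measurable[env.linkAlgebra t] fun ω => env.e l n t ω / env.q l n - 1 :=
    fun t => ((env.measurable_e hn t).div_const _).sub_const _
  have hg : ∀ t, MemLp (fun ω => env.e l n t ω / env.q l n - 1) 2 μ := fun t =>
    MemLp.of_bound ((hgm t).mono (env.linkAlgebra_le t) le_rfl).aestronglyMeasurable
      (1 / env.q l n) (Eventually.of_forall fun ω => (env.abs_e_div_q_le hn t ω).2)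
  have hind := fun t => (env.indep_err_link t).indepFun_of_measurable (hfm t) (hgm t)
  have hf := env.memLp_meanCoeff_add_err l n
  refine ⟨fun t => ((hfm t).mono (env.errAlgebra_le_innovation t) le_rfl).mul
      ((hgm t).mono (env.linkAlgebra_le_innovation t) le_rfl),
    fun t => (hind t).memLp_two_mul (hf t) (hg t), fun t => ?_, ?_⟩
  · have he : Integrable (env.e l n t) μ := by
      refine Integrable.of_bound (env.e_measurable l n hn t).aestronglyMeasurable 1
        (Eventually.of_forall fun ω => ?_)
      rcases env.e_binary l n hn t ω with h | h <;> simp [h]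
    -- The coefficient itself is not centred; the mean vanishes because dividing by `q` normalizes
    -- the link factor to mean one.
    rw [(hind t).integral_fun_mul_eq_mul_integral (hf t).1 (hg t).1,
      integral_sub (he.div_const _) (integrable_const _), integral_div, env.integral_e hn,
      div_self (env.q_pos l n hn).ne']
    simp
  · obtain ⟨c, hc0, hc⟩ := env.exists_integral_meanCoeff_add_err_sq_le l n
    refine ⟨c * (1 / env.q l n) ^ 2, fun t => ?_⟩
    rw [(hind t).integral_mul_sq (hf t) (hg t)]
    exact mul_le_mul (hc t) (integral_sq_le_of_abs_le (hg t) fun ω => (env.abs_e_div_q_le hn t ω).2)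
      (integral_nonneg fun ω => sq_nonneg _) hc0

/-- The channel noise received over one link. -/
theorem isNoise_channel [IsProbabilityMeasure μ] {l : Fin M} {n : Node m M}
    (hn : n ∈ net.Θ l) (j : Fin m) : IsNoise env.innovation μ fun t ω =>
      (env.meanCoeff l n + env.err l n t ω) * (env.e l n t ω / env.q l n) * env.v l n j t ω := by
  have hfm : ∀ t, Measurable[env.errAlgebra t] fun ω => env.meanCoeff l n + env.err l n t ω :=
    fun t => (env.measurable_err l n t).const_add _
  have hgm : ∀ t, Measurable[env.linkAlgebra t] fun ω => env.e l n t ω / env.q l n :=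
    fun t => (env.measurable_e hn t).div_const _
  have hg : ∀ t, MemLp (fun ω => env.e l n t ω / env.q l n) 2 μ := fun t =>
    MemLp.of_bound ((hgm t).mono (env.linkAlgebra_le t) le_rfl).aestronglyMeasurable
      (1 / env.q l n) (Eventually.of_forall fun ω => (env.abs_e_div_q_le hn t ω).1)
  have hind := fun t => (env.indep_err_link t).indepFun_of_measurable (hfm t) (hgm t)
  have hf := env.memLp_meanCoeff_add_err l n
  have hfg := fun t => (hind t).memLp_two_mul (hf t) (hg t)
  have hfgm : ∀ t, Measurable[env.errAlgebra t ⊔ env.linkAlgebra t] fun ω =>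
      (env.meanCoeff l n + env.err l n t ω) * (env.e l n t ω / env.q l n) := fun t =>
    ((hfm t).mono le_sup_left le_rfl).mul ((hgm t).mono le_sup_right le_rfl)
  have hv := env.v_memLp l n hn j
  have hind' := fun t => (env.indep_err_link_channel t (⟨(l, n), hn⟩, j, t)).indepFun_of_measurable
    (hfgm t) (env.measurable_v hn j t)
  refine ⟨fun t => ((hfgm t).mono (sup_le (env.errAlgebra_le_innovation t)
      (env.linkAlgebra_le_innovation t)) le_rfl).mul ((env.measurable_v hn j t).mono
        (env.channelAlgebra_le_innovation (⟨(l, n), hn⟩, j, t)) le_rfl),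
    fun t => (hind' t).memLp_two_mul (hfg t) (hv t), fun t => ?_, ?_⟩
  · rw [(hind' t).integral_fun_mul_eq_mul_integral (hfg t).1 (hv t).1, env.v_mean l n hn, mul_zero]
  · obtain ⟨c, hc0, hc⟩ := env.exists_integral_meanCoeff_add_err_sq_le l n
    obtain ⟨b, hb⟩ := env.v_bound
    refine ⟨c * (1 / env.q l n) ^ 2 * b, fun t => ?_⟩
    rw [(hind' t).integral_mul_sq (hfg t) (hv t), (hind t).integral_mul_sq (hf t) (hg t)]
    refine mul_le_mul (mul_le_mul (hc t) (integral_sq_le_of_abs_le (hg t)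
      fun ω => (env.abs_e_div_q_le hn t ω).1) (integral_nonneg fun ω => sq_nonneg _) hc0)
      (hb l n hn j t) (integral_nonneg fun ω => sq_nonneg _) (by positivity)

/-- Off the links nothing is known about `e`, `q` and `v`; this vanishing coefficient removes them,
so the noise estimates extend to all pairs of a sensor and a node. -/
theorem meanCoeff_add_err_eq_zero {l : Fin M} {n : Node m M} (hn : n ∉ net.Θ l) (t : ℕ) (ω : Ω) :
    env.meanCoeff l n + env.err l n t ω = 0 := by
  rcases n with k | n
  · simp [meanCoeff, err, SensorNetwork.B, SensorNetwork.bary, hn, env.SB_support l k hn,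
      env.errB_support t ω l k hn]
  · simp [meanCoeff, err, SensorNetwork.P, SensorNetwork.bary, hn, env.SP_support l n hn,
      env.errP_support t ω l n hn]

theorem isNoise_err_add_failure [IsProbabilityMeasure μ] (l : Fin M) (n : Node m M) :
    IsNoise env.innovation μ fun t ω => env.err l n t ω +
      (env.meanCoeff l n + env.err l n t ω) * (env.e l n t ω / env.q l n - 1) := by
  refine (env.isNoise_err l n).add ?_
  by_cases hn : n ∈ net.Θ l
  · exact env.isNoise_link_failure hn
  · simp only [env.meanCoeff_add_err_eq_zero hn, zero_mul]
    exact IsNoise.zero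

theorem isNoise_received [IsProbabilityMeasure μ] (l : Fin M) (n : Node m M) (j : Fin m) :
    IsNoise env.innovation μ fun t ω => ((env.meanCoeff l n + env.err l n t ω) +
      (env.meanCoeff l n + env.err l n t ω) * (env.e l n t ω / env.q l n - 1)) *
        env.v l n j t ω := by
  by_cases hn : n ∈ net.Θ l
  -- The coefficient and its failure fluctuation add up to the coefficient times `e / q`.
  · convert env.isNoise_channel hn j using 4
    ring
  · simp only [env.meanCoeff_add_err_eq_zero hn, zero_mul, add_zero]
    exact IsNoise.zero

theorem isNoise_errP_add_tildeP [IsProbabilityMeasure μ] (l n : Fin M) :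
    IsNoise env.innovation μ fun t ω => (env.errP t ω + env.tildeP t ω) l n :=
  env.isNoise_err_add_failure l (Sum.inr n)

theorem isNoise_errB_add_tildeB [IsProbabilityMeasure μ] (l : Fin M) (k : Fin (m + 1)) :
    IsNoise env.innovation μ fun t ω => (env.errB t ω + env.tildeB t ω) l k :=
  env.isNoise_err_add_failure l (Sum.inl k)

theorem isNoise_eta [IsProbabilityMeasure μ] (j : Fin m) (l : Fin M) :
    IsNoise env.innovation μ fun t ω => env.eta j t ω l :=
  (IsNoise.sum _ fun n _ => env.isNoise_received l (Sum.inr n) j).add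
    (IsNoise.sum _ fun k _ => env.isNoise_received l (Sum.inl k) j)

end RandomEnvironment

end DLRE

/-! ### Geometry of the network: invertibility of `1 - P` and the localization error -/

namespace DLRE

namespace SensorNetwork

variable {m M : ℕ} (net : SensorNetwork m M)

theorem sum_bary_smul {E : Type*} [AddCommGroup E] [Module ℝ E] (l : Fin M) (f : Node m M → E) :
    ∑ n, net.bary l n • f n =
      ∑ k : {k // k ∈ net.Θ l}, (net.triangulationBasis l).coord k (net.pos (Sum.inr l)) • f k := by
  rw [← Finset.sum_subset (Finset.subset_univ (net.Θ l)) fun n _ hn => by simp [bary, hn],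
    ← Finset.sum_coe_sort]
  refine Finset.sum_congr rfl fun k _ => ?_
  rw [bary, dif_pos k.2]

theorem sum_bary (l : Fin M) : ∑ n, net.bary l n = 1 := by
  have h := net.sum_bary_smul l fun _ => (1 : ℝ)
  simp only [smul_eq_mul, mul_one] at h
  rw [h, AffineBasis.sum_coord_apply_eq_one]

theorem sum_bary_smul_pos (l : Fin M) :
    ∑ n, net.bary l n • net.pos n = net.pos (Sum.inr l) := by
  rw [net.sum_bary_smul]
  exact (net.triangulationBasis l).linear_combination_coord_eq_self _

theorem bary_nonneg (l : Fin M) (n : Node m M) : 0 ≤ net.bary l n := by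
  rw [bary]
  split_ifs with h
  · have h1 := net.mem_hull l
    have h2 : net.pos '' (net.Θ l : Set (Node m M)) = Set.range (net.triangulationBasis l) := by
      rw [Set.image_eq_range]; rfl
    rw [h2, AffineBasis.convexHull_eq_nonneg_coord] at h1
    exact h1 _
  · exact le_rfl

/-- Strict convexity of the squared norm in the form of a variance identity: the gap is the weighted
mean of `‖pos n - pos l‖ ^ 2`. It is positive since some weight is nonzero and nodes other than `l`
lie elsewhere. -/
theorem sq_norm_lt_sum_bary (l : Fin M) :
    ‖net.pos (Sum.inr l)‖ ^ 2 < ∑ n, net.bary l n * ‖net.pos n‖ ^ 2 := by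
  have h1 : ∑ n, net.bary l n * ‖net.pos n - net.pos (Sum.inr l)‖ ^ 2 =
      ∑ n, net.bary l n * ‖net.pos n‖ ^ 2 - ‖net.pos (Sum.inr l)‖ ^ 2 := by
    have h2 : ∑ n, net.bary l n * inner ℝ (net.pos n) (net.pos (Sum.inr l)) =
        ‖net.pos (Sum.inr l)‖ ^ 2 := by
      rw [← real_inner_self_eq_norm_sq]
      conv_rhs => lhs; rw [← net.sum_bary_smul_pos l]
      simp only [sum_inner, real_inner_smul_left]
    simp only [norm_sub_sq_real]
    have h3 : ∀ n, net.bary l n * (‖net.pos n‖ ^ 2 - 2 * inner ℝ (net.pos n) (net.pos (Sum.inr l))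
        + ‖net.pos (Sum.inr l)‖ ^ 2) = net.bary l n * ‖net.pos n‖ ^ 2
        - 2 * (net.bary l n * inner ℝ (net.pos n) (net.pos (Sum.inr l)))
        + net.bary l n * ‖net.pos (Sum.inr l)‖ ^ 2 := fun n => by ring
    simp only [h3]
    rw [Finset.sum_add_distrib, Finset.sum_sub_distrib, ← Finset.mul_sum, ← Finset.sum_mul, h2,
      net.sum_bary]
    ring
  have h4 : 0 < ∑ n, net.bary l n * ‖net.pos n - net.pos (Sum.inr l)‖ ^ 2 := by
    obtain ⟨n, -, hn⟩ : ∃ n ∈ Finset.univ, net.bary l n ≠ 0 := by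
      refine Finset.exists_ne_zero_of_sum_ne_zero ?_
      rw [net.sum_bary]; exact one_ne_zero
    refine Finset.sum_pos' (fun n _ => mul_nonneg (net.bary_nonneg l n) (sq_nonneg _))
      ⟨n, Finset.mem_univ n, mul_pos ((net.bary_nonneg l n).lt_of_ne' hn) ?_⟩
    have hne : n ≠ Sum.inr l := by
      rintro rfl
      exact hn (by simp [bary, net.self_notMem l])
    have := norm_pos_iff.2 (sub_ne_zero.2 (net.pos_injective.ne hne))
    positivity
  linarith

theorem sum_bary_mul_eq (l : Fin M) (f : Node m M → ℝ) :
    ∑ n, net.bary l n * f n = net.B.mulVec (fun k => f (Sum.inl k)) l +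
      net.P.mulVec (fun n => f (Sum.inr n)) l := by
  rw [Fintype.sum_sum_type]
  rfl

/-- Maximum principle: a fixed point of `P` is nonpositive. -/
theorem le_zero_of_P_mulVec_eq {x : Fin M → ℝ} (hx : net.P.mulVec x = x) (l : Fin M) :
    x l ≤ 0 := by
  obtain ⟨C, hC⟩ : ∃ C, ∀ n, ‖net.pos n‖ ^ 2 ≤ C := by
    refine ⟨∑ n, ‖net.pos n‖ ^ 2, fun n => Finset.single_le_sum (f := fun n => ‖net.pos n‖ ^ 2)
      (fun _ _ => sq_nonneg _) (Finset.mem_univ n)⟩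
  have key : ∀ ε : ℝ, 0 < ε → x l ≤ ε * C := by
    intro ε hε
    -- Extended by zero to the anchors, `x` equals its weighted average at every sensor. The term `ε
    -- * ‖pos‖ ^ 2` makes `y` strictly smaller than its average there, so the maximum sits at an
    -- anchor; this replaces any argument about paths from sensors to anchors.
    let y : Node m M → ℝ := fun n => Sum.elim (fun _ => 0) x n + ε * ‖net.pos n‖ ^ 2
    obtain ⟨n₀, hn₀⟩ := Finite.exists_max y
    have hl : x l ≤ y (Sum.inr l) := by
      simp only [y, Sum.elim_inr]; nlinarith [sq_nonneg ‖net.pos (Sum.inr l)‖]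
    refine (hl.trans (hn₀ _)).trans ?_
    rcases n₀ with k | i
    · simp only [y, Sum.elim_inl, zero_add]
      exact mul_le_mul_of_nonneg_left (hC _) hε.le
    · exfalso
      have h1 : ∑ n, net.bary i n * y n ≤ ∑ n, net.bary i n * y (Sum.inr i) :=
        Finset.sum_le_sum fun n _ => mul_le_mul_of_nonneg_left (hn₀ n) (net.bary_nonneg i n)
      rw [← Finset.sum_mul, net.sum_bary, one_mul] at h1
      have h2 : ∑ n, net.bary i n * y n = x i + ε * ∑ n, net.bary i n * ‖net.pos n‖ ^ 2 := by
        have h3 := net.sum_bary_mul_eq i (Sum.elim (fun _ => 0) x)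
        simp only [Sum.elim_inl, Sum.elim_inr] at h3
        rw [hx] at h3
        have h4 : net.B.mulVec (fun _ => 0) i = 0 := congrFun (Matrix.mulVec_zero net.B) i
        rw [h4, zero_add] at h3
        simp only [y, mul_add, Finset.sum_add_distrib]
        rw [h3, Finset.mul_sum]
        congr 1
        exact Finset.sum_congr rfl fun n _ => by ring
      have h5 := net.sq_norm_lt_sum_bary i
      have h6 : y (Sum.inr i) = x i + ε * ‖net.pos (Sum.inr i)‖ ^ 2 := rfl
      nlinarith [mul_lt_mul_of_pos_left h5 hε]
  have h0 : Tendsto (fun ε : ℝ => ε * C) (𝓝[>] 0) (𝓝 0) := by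
    have : Tendsto (fun ε : ℝ => ε * C) (𝓝 0) (𝓝 (0 * C)) := tendsto_id.mul_const C
    rw [zero_mul] at this
    exact this.mono_left nhdsWithin_le_nhds
  exact ge_of_tendsto h0 (eventually_nhdsWithin_of_forall fun ε hε => key ε hε)

/-- The maximum principle applied to `x` and `-x` leaves no nonzero fixed point. The spectral
assumption on the biased matrix plays no role here. -/
theorem isUnit_one_sub_P : IsUnit (1 - net.P) := by
  rw [← Matrix.mulVec_injective_iff_isUnit]
  refine (injective_iff_map_eq_zero (Matrix.mulVecLin (1 - net.P))).2 fun x hx => ?_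
  simp only [Matrix.mulVecLin_apply, Matrix.sub_mulVec, Matrix.one_mulVec, sub_eq_zero] at hx
  ext l
  refine le_antisymm (net.le_zero_of_P_mulVec_eq hx.symm l) ?_
  have := net.le_zero_of_P_mulVec_eq (x := -x) (by rw [Matrix.mulVec_neg, ← hx]) l
  simpa using this

theorem one_sub_P_mulVec_pos (j : Fin m) :
    (1 - net.P).mulVec (fun l => net.pos (Sum.inr l) j) = net.B.mulVec (net.u j) := by
  ext l
  have h := net.sum_bary_mul_eq l fun n => net.pos n j
  have h1 : ∑ n, net.bary l n * net.pos n j = net.pos (Sum.inr l) j := by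
    conv_rhs => rw [← net.sum_bary_smul_pos l]
    simp
  rw [h1] at h
  rw [Matrix.sub_mulVec, Matrix.one_mulVec, Pi.sub_apply, h, add_sub_cancel_right]
  rfl

theorem steadyState_zero (j : Fin m) :
    net.steadyState 0 0 j = fun l => net.pos (Sum.inr l) j := by
  rw [steadyState, sub_zero, add_zero, ← Matrix.mulVec_mulVec, ← one_sub_P_mulVec_pos,
    Matrix.mulVec_mulVec, Matrix.nonsing_inv_mul _ ((Matrix.isUnit_iff_isUnit_det _).1
      net.isUnit_one_sub_P), Matrix.one_mulVec]

theorem localizationError_zero : net.localizationError 0 0 = 0 := by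
  simp [localizationError, steadyState_zero]

theorem continuousAt_localizationError :
    ContinuousAt (fun S : Matrix (Fin M) (Fin M) ℝ × Matrix (Fin M) (Fin (m + 1)) ℝ =>
      net.localizationError S.1 S.2) (0, 0) := by
  have h1 : ContinuousAt (fun S : Matrix (Fin M) (Fin M) ℝ × Matrix (Fin M) (Fin (m + 1)) ℝ =>
      (1 - net.P - S.1)⁻¹) (0, 0) := by
    have hdet : (1 - net.P - (0 : Matrix (Fin M) (Fin M) ℝ)).det ≠ 0 := by
      rw [sub_zero]
      exact ((Matrix.isUnit_iff_isUnit_det _).1 net.isUnit_one_sub_P).ne_zero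
    -- Written as inverse determinant times adjugate, the inverse is continuous wherever the
    -- determinant is nonzero.
    simp only [Matrix.inv_def, Ring.inverse_eq_inv']
    have hc : Continuous fun S : Matrix (Fin M) (Fin M) ℝ × Matrix (Fin M) (Fin (m + 1)) ℝ =>
      1 - net.P - S.1 := by fun_prop
    exact (hc.matrix_det.continuousAt.inv₀ hdet).smul hc.matrix_adjugate.continuousAt
  have h2 : ∀ j, ContinuousAt (fun S : Matrix (Fin M) (Fin M) ℝ × Matrix (Fin M) (Fin (m + 1)) ℝ =>
      net.steadyState S.1 S.2 j) (0, 0) := by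
    intro j
    have h3 : Continuous fun p : Matrix (Fin M) (Fin M) ℝ × Matrix (Fin M) (Fin (m + 1)) ℝ =>
        (p.1 * (net.B + p.2)).mulVec (net.u j) :=
      (continuous_fst.matrix_mul (continuous_const.add continuous_snd)).matrix_mulVec
        continuous_const
    exact ContinuousAt.comp (f := fun S : Matrix (Fin M) (Fin M) ℝ × Matrix (Fin M) (Fin (m + 1)) ℝ
      => ((1 - net.P - S.1)⁻¹, S.2)) h3.continuousAt (h1.prodMk continuousAt_snd)
  have h3 : ∀ l j, ContinuousAt (fun S : Matrix (Fin M) (Fin M) ℝ × Matrix (Fin M) (Fin (m + 1)) ℝ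
      => (net.steadyState S.1 S.2 j l - net.pos (Sum.inr l) j) ^ 2) (0, 0) := fun l j =>
    ((continuousAt_pi.1 (h2 j) l).sub continuousAt_const).pow 2
  have h4 : ContinuousAt (fun S : Matrix (Fin M) (Fin M) ℝ × Matrix (Fin M) (Fin (m + 1)) ℝ
      => ∑ l, ∑ j, (net.steadyState S.1 S.2 j l - net.pos (Sum.inr l) j) ^ 2) (0, 0) :=
    tendsto_finsetSum _ fun l _ => tendsto_finsetSum _ fun j _ => h3 l j
  exact h4.sqrt

end SensorNetwork

/-- A strict contraction has no nonzero fixed point. -/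
theorem isUnit_one_sub_of_spectralRadius_lt_one {ι : Type*} [Fintype ι] [DecidableEq ι]
    {W : Matrix ι ι ℝ} (h : spectralRadius ℂ (W.map (algebraMap ℝ ℂ)) < 1) : IsUnit (1 - W) := by
  obtain ⟨N, T, c, -, hc1, hTW, hT⟩ := exists_contracting_embedding W h
  rw [← Matrix.mulVec_injective_iff_isUnit]
  refine (injective_iff_map_eq_zero (Matrix.mulVecLin (1 - W))).2 fun x hx => ?_
  simp only [Matrix.mulVecLin_apply, Matrix.sub_mulVec, Matrix.one_mulVec, sub_eq_zero] at hx
  have h1 := hTW x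
  rw [← hx] at h1
  have h2 : ‖T x‖ = 0 := by nlinarith [norm_nonneg (T x)]
  ext i
  have h3 := hT x i
  rw [h2, mul_zero] at h3
  exact abs_nonpos_iff.1 h3

/-! ### Convergence of the algorithm from every initial state -/

namespace RandomEnvironment

variable {m M : ℕ} {net : SensorNetwork m M} {Ω : Type*} [mΩ : MeasurableSpace Ω] {μ : Measure Ω}
  (env : RandomEnvironment net μ)

theorem ae_tendsto_state_const [IsProbabilityMeasure μ]
    {α : ℕ → ℝ} (hα_pos : ∀ t, 0 < α t)
    (hα_sum : Tendsto (fun n => ∑ t ∈ Finset.range n, α t) atTop atTop)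
    (hα_sq : Summable fun t => α t ^ 2)
    (hρ : spectralRadius ℂ ((net.P + env.SP).map (algebraMap ℝ ℂ)) < 1)
    (j : Fin m) (x₀ : Fin M → ℝ) :
    ∀ᵐ ω ∂μ, Tendsto (env.state α j x₀ ω) atTop (𝓝 (net.steadyState env.SP env.SB j)) := by
  set z := net.steadyState env.SP env.SB j with hz
  have hunit := isUnit_one_sub_of_spectralRadius_lt_one hρ
  rw [← sub_sub] at hunit
  have hfix : (1 - net.P - env.SP).mulVec z = (net.B + env.SB).mulVec (net.u j) := by
    rw [hz, SensorNetwork.steadyState, Matrix.mulVec_mulVec, ← Matrix.mul_assoc,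
      Matrix.mul_nonsing_inv _ ((Matrix.isUnit_iff_isUnit_det _).1 hunit), Matrix.one_mul]
  have hD := env.isNoise_errP_add_tildeP
  -- Centring at `z` splits the multiplicative noise: `D x = D (x - z) + D z`, and the part `D z`
  -- joins the additive noise.
  have hd : ∀ l, IsNoise env.innovation μ fun t ω =>
      ((env.errP t ω + env.tildeP t ω).mulVec z +
        (env.errB t ω + env.tildeB t ω).mulVec (net.u j) + env.eta j t ω) l := fun l =>
    ((IsNoise.sum Finset.univ fun n _ => (hD l n).mul_const (z n)).add
      (IsNoise.sum Finset.univ fun k _ =>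
        (env.isNoise_errB_add_tildeB l k).mul_const (net.u j k))).add (env.isNoise_eta j l)
  have h := ae_tendsto_zero_of_linear_stochastic_approximation hρ env.innovation_le
    env.indep_pastFiltration_innovation hD hd hα_pos hα_sum hα_sq
    (y := fun t ω => env.state α j x₀ ω t - z) (y₀ := x₀ - z) (fun ω => rfl) fun t ω => by
      have h1 : env.state α j x₀ ω (t + 1) = env.state α j x₀ ω t - α t •
        ((1 - net.P - env.SP).mulVec (env.state α j x₀ ω t) - (net.B + env.SB).mulVec (net.u j)
        - (env.errP t ω + env.tildeP t ω).mulVec (env.state α j x₀ ω t)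
        - (env.errB t ω + env.tildeB t ω).mulVec (net.u j) - env.eta j t ω) := rfl
      have h2 : (fun i => ∑ n, (env.errP t ω + env.tildeP t ω) i n *
          (env.state α j x₀ ω t - z) n + ((env.errP t ω + env.tildeP t ω).mulVec z +
          (env.errB t ω + env.tildeB t ω).mulVec (net.u j) + env.eta j t ω) i) =
          (env.errP t ω + env.tildeP t ω).mulVec (env.state α j x₀ ω t) +
          (env.errB t ω + env.tildeB t ω).mulVec (net.u j) + env.eta j t ω := by
        change (env.errP t ω + env.tildeP t ω).mulVec (env.state α j x₀ ω t - z) +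
          ((env.errP t ω + env.tildeP t ω).mulVec z +
          (env.errB t ω + env.tildeB t ω).mulVec (net.u j) + env.eta j t ω) = _
        rw [Matrix.mulVec_sub]; abel
      have h3 : (env.state α j x₀ ω t - z) - (net.P + env.SP).mulVec (env.state α j x₀ ω t - z) =
          (1 - net.P - env.SP).mulVec (env.state α j x₀ ω t) -
            (net.B + env.SB).mulVec (net.u j) := by
        rw [← hfix, ← Matrix.mulVec_sub, sub_sub (1 : Matrix _ _ ℝ), Matrix.sub_mulVec, Matrix.one_mulVec]
      rw [h2, h3, h1]
      module
  filter_upwards [h] with ω hω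
  simpa using hω.add_const z

theorem exists_state_eq_affine (α : ℕ → ℝ) (j : Fin m) (ω : Ω) (t : ℕ) :
    ∃ (A : Matrix (Fin M) (Fin M) ℝ) (b : Fin M → ℝ), ∀ x₀,
      env.state α j x₀ ω t = A.mulVec x₀ + b := by
  induction t with
  | zero => exact ⟨1, 0, fun x₀ => by simp [state]⟩
  | succ t ih =>
    obtain ⟨A, b, h⟩ := ih
    refine ⟨A - α t • ((1 - net.P - env.SP) * A - (env.errP t ω + env.tildeP t ω) * A),
      b - α t • ((1 - net.P - env.SP).mulVec b - (net.B + env.SB).mulVec (net.u j)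
      - (env.errP t ω + env.tildeP t ω).mulVec b
      - (env.errB t ω + env.tildeB t ω).mulVec (net.u j) - env.eta j t ω), fun x₀ => ?_⟩
    simp only [state, h]
    rw [Matrix.sub_mulVec A, Matrix.smul_mulVec, Matrix.sub_mulVec (_ * A), ← Matrix.mulVec_mulVec,
      ← Matrix.mulVec_mulVec, Matrix.mulVec_add, Matrix.mulVec_add]
    module

/-- The null set in the almost sure statement depends on the initial state. Affine dependence
reduces all initial states to finitely many, so a random one needs neither measurability nor
independence of the noise. -/
theorem tendsto_state_of_tendsto_state_basis (α : ℕ → ℝ) (j : Fin m) (ω : Ω) {z : Fin M → ℝ}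
    (h0 : Tendsto (env.state α j 0 ω) atTop (𝓝 z))
    (h1 : ∀ i, Tendsto (env.state α j (Pi.single i 1) ω) atTop (𝓝 z)) (x₀ : Fin M → ℝ) :
    Tendsto (env.state α j x₀ ω) atTop (𝓝 z) := by
  have h2 : env.state α j x₀ ω = fun t => env.state α j 0 ω t +
      ∑ i, x₀ i • (env.state α j (Pi.single i 1) ω t - env.state α j 0 ω t) := by
    ext1 t
    obtain ⟨A, b, h⟩ := env.exists_state_eq_affine α j ω t
    simp only [h, Matrix.mulVec_zero, zero_add, add_sub_cancel_right]
    rw [add_comm]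
    congr 1
    ext l
    simp [Matrix.mulVec, dotProduct, Finset.sum_apply, mul_comm]
  rw [h2]
  have h3 := h0.add (tendsto_finsetSum Finset.univ fun i _ => ((h1 i).sub h0).const_smul (x₀ i))
  simpa using h3

end RandomEnvironment

end DLRE

theorem theorem3 {m M : ℕ} (net : DLRE.SensorNetwork m M)
    {Ω : Type*} [MeasurableSpace Ω] (μ : Measure Ω) [IsProbabilityMeasure μ]
    (env : DLRE.RandomEnvironment net μ)
    (α : ℕ → ℝ) (hα_pos : ∀ t, 0 < α t)
    (hα_sum : Tendsto (fun n => ∑ t ∈ Finset.range n, α t) atTop atTop)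
    (hα_sq : Summable fun t => α t ^ 2)
    (hρ : spectralRadius ℂ ((net.P + env.SP).map (algebraMap ℝ ℂ)) < 1)
    (x₀ : Fin m → Ω → Fin M → ℝ) :
    IsUnit (1 - net.P - env.SP) ∧
    (∀ᵐ ω ∂μ, ∀ j : Fin m,
      Tendsto (fun t => env.state α j (x₀ j ω) ω t) atTop
        (𝓝 (((1 - net.P - env.SP)⁻¹ * (net.B + env.SB)).mulVec (net.u j)))) ∧
    net.localizationError 0 0 = 0 ∧
    Tendsto
      (fun S : Matrix (Fin M) (Fin M) ℝ × Matrix (Fin M) (Fin (m + 1)) ℝ =>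
        net.localizationError S.1 S.2)
      (𝓝 (0, 0)) (𝓝 0) := by
  refine ⟨?_, ?_, net.localizationError_zero, ?_⟩
  · rw [sub_sub]
    exact DLRE.isUnit_one_sub_of_spectralRadius_lt_one hρ
  · have h := env.ae_tendsto_state_const hα_pos hα_sum hα_sq hρ
    have h0 := ae_all_iff.2 fun j => h j 0
    have h1 := ae_all_iff.2 fun j => ae_all_iff.2 fun i => h j (Pi.single i 1)
    filter_upwards [h0, h1] with ω h0 h1 j
    exact env.tendsto_state_of_tendsto_state_basis α j ω (h0 j) (h1 j) (x₀ j ω)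
  · have h := net.continuousAt_localizationError
    rw [ContinuousAt, net.localizationError_zero] at h
    exact h
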